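/- All posets are finite. Let $\mathcal{P}$ be a bounded poset with least element $\hat 0$ and greatest element $\hat 1$, and write $p\lessdot q$ if $q$ covers $p$. For $m>0$ let the *$m$-cover poset* $\mathcal{P}^{\langle m\rangle}$ be the set of all $m$-tuples $(\hat0^{\,l_0},p^{\,l_1},q^{\,l_2})$ (that is, $l_0$ entries $\hat 0$, then $l_1$ entries $p$, then $l_2$ entries $q$) with $p\lessdot q$ in $\mathcal{P}$, $l_0,l_1,l_2\ge 0$ and $l_0+l_1+l_2=m$, together with the constant tuple $(\hat 0^{\,m})$, ordered componentwise. For $k,l\ge 0$ let $\mathcal{P}_{k,l}$ be the bounded poset whose proper part (the poset without $\hat 0,\hat 1$) is the disjoint union of a $k$-element chain and an $l$-element antichain. Let $\mathfrak{p}$ be a northeast path, given by a word $w_1\cdots w_n$ $(n\ge 0)$ in the letters $N,E$. The *path order* $\le_{\mathfrak p}$ on $\{w_1,\dots,w_n\}$ is the reflexive transitive closure of the following relations: each $w_i=N$ is below the next occurrence $w_j=N$, and each $w_j=E$ is below the letter $N$ immediately preceding the maximal block of consecutive letters $E$ that contains $w_j$ (if there is such an $N$). The *path poset* $\mathcal{P}_{k,l;\mathfrak{p}}$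 is the disjoint union of $\mathcal{P}_{k,l}$ and $\{w_1,\dots,w_n\}$ with $x\le y$ if and only if one of the following holds: $x,y\in\mathcal{P}_{k,l}$ and $x\le y$ there; $x,y\notin\mathcal{P}_{k,l}$ and $x\le_{\mathfrak p}y$; $x=\hat 0\in\mathcal{P}_{k,l}$ and $y=w_j=E$ for some $j$; $x\in\mathcal{P}_{k,l}$ and $y=w_j=N$ for some $j$. A poset is *$(\mathbf{2+2})$-free* if it does not contain elements $x<y$ and $x'<y'$ such that each of $x,y$ is incomparable to each of $x',y'$. An element $p$ of a lattice is *left-modular* if $(q\vee p)\wedge q'=q\vee(p\wedge q')$ for all $q<q'$. A lattice is *left-modular* if it has a saturated maximal chain $\hat 0=p_1\lessdot\cdots\lessdot p_s=\hat 1$ of left-modular elements. A bounded poset is *EL-shellable* if its cover relations can be labeled by elements of some poset such that every interval has a unique saturated maximal chain with strictly increasing label sequence, and the label sequence of this chain lexicographically precedes those of all other saturated maximal chains of the interval. **Theorem.** Let $\mathcal{P}$ be a finite bounded poset such that $\mathcal{P}^{\langle m\rangle}$ is a lattice for all $m>0$. Then for every $m>0$ the following are equivalent: (a) $\mathcal{P}$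 is a singleton, or $\mathcal{P}\cong\mathcal{P}_{k,l;\mathfrak{p}}$ for some $k,l\ge 0$ and some northeast path $\mathfrak{p}$; (b) $\mathcal{P}$ is $(\mathbf{2+2})$-free; (c) $\mathcal{P}^{\langle m\rangle}$ is left-modular; (d) $\mathcal{P}^{\langle m\rangle}$ is EL-shellable. -/

import Mathlib

namespace CoverPoset

/-! ### Lattices, saturated chains, left-modularity -/

/-- The poset `P` is a lattice: any two elements have a join and a meet. -/
def IsLatticePoset (P : Type*) [PartialOrder P] : Prop :=
  ∀ p q : P, (∃ j, IsLUB {p, q} j) ∧ (∃ i, IsGLB {p, q} i)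

/-- The (unique) lattice structure on a poset that is a lattice; the order is the given one. -/
@[reducible] noncomputable def IsLatticePoset.toLattice {P : Type*} [inst : PartialOrder P]
    (h : IsLatticePoset P) : Lattice P :=
  { inst with
    sup := fun p q => (h p q).1.choose
    le_sup_left := fun p q => (h p q).1.choose_spec.1 (by simp)
    le_sup_right := fun p q => (h p q).1.choose_spec.1 (by simp)
    sup_le := fun p q r hp hq => (h p q).1.choose_spec.2 (by
      rintro x (rfl | rfl)
      · exact hp
      · exact hq)
    inf := fun p q => (h p q).2.choose
    inf_le_left := fun p q => (h p q).2.choose_spec.1 (by simp)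
    inf_le_right := fun p q => (h p q).2.choose_spec.1 (by simp)
    le_inf := fun r p q hp hq => (h p q).2.choose_spec.2 (by
      rintro x (rfl | rfl)
      · exact hp
      · exact hq) }

/-- `c` lists a saturated maximal chain `x = c₁ ⋖ c₂ ⋖ ⋯ ⋖ cₛ = y` of the interval `[x, y]`. -/
def IsSaturatedChain {P : Type*} [PartialOrder P] (x y : P) (c : List P) : Prop :=
  c.IsChain (· ⋖ ·) ∧ c.head? = some x ∧ c.getLast? = some y

/-- The element `p` of a lattice is left-modular. -/
def IsLeftModularElem {L : Type*} [Lattice L] (p : L) : Prop :=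
  ∀ q q' : L, q < q' → (q ⊔ p) ⊓ q' = q ⊔ (p ⊓ q')

/-- The poset `P` is a left-modular lattice: it is a lattice, and some saturated maximal chain,
from the least to the greatest element, consists of left-modular elements. -/
def IsLeftModularLattice (P : Type*) [PartialOrder P] : Prop :=
  ∃ h : IsLatticePoset P, letI := h.toLattice
    ∃ (bot top : P) (c : List P), IsBot bot ∧ IsTop top ∧ IsSaturatedChain bot top c ∧
      ∀ p ∈ c, IsLeftModularElem p

/-! ### EL-shellability -/

/-- The sequence of labels of the consecutive edges of the chain `c`. -/
def edgeLabels {P Λ : Type*} (lab : P → P → Λ) (c : List P) : List Λ :=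
  List.zipWith lab c c.tail

/-- The sequence of edge labels of the chain `c` is strictly increasing. -/
def IsRising {P Λ : Type*} [PartialOrder Λ] (lab : P → P → Λ) (c : List P) : Prop :=
  (edgeLabels lab c).IsChain (· < ·)

/-- `lab` is an EL-labeling of `P`, where `lab p q` is the label of the edge `p ⋖ q` (the other
values of `lab` are never used): every interval `[x, y]` has a unique rising saturated maximal
chain, and its label sequence lexicographically precedes that of every other saturated maximal
chain of the interval. -/
def IsELLabeling {P Λ : Type*} [PartialOrder P] [PartialOrder Λ] (lab : P → P → Λ) : Prop :=
  ∀ x y : P, x ≤ y →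
    ∃ c : List P, IsSaturatedChain x y c ∧ IsRising lab c ∧
      (∀ d : List P, IsSaturatedChain x y d → IsRising lab d → d = c) ∧
      (∀ d : List P, IsSaturatedChain x y d → d ≠ c →
        List.Lex (· < ·) (edgeLabels lab c) (edgeLabels lab d))

/-- The poset `P` is bounded and admits an EL-labeling with labels in some poset. For finite `P`,
as considered here, only finitely many labels occur, so it suffices to let the poset of labels
range over `Type`. -/
def IsELShellable (P : Type*) [PartialOrder P] : Prop :=
  (∃ x : P, IsBot x) ∧ (∃ y : P, IsTop y) ∧
    ∃ (Λ : Type) (_ : PartialOrder Λ) (lab : P → P → Λ), IsELLabeling lab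

/-! ### Posets without a `2+2` -/

/-- The poset `P` is `(2+2)`-free. -/
def IsTwoPlusTwoFree (P : Type*) [PartialOrder P] : Prop :=
  ¬ ∃ x y x' y' : P, x < y ∧ x' < y' ∧
    (¬ x ≤ x' ∧ ¬ x ≤ y' ∧ ¬ y ≤ x' ∧ ¬ y ≤ y') ∧
    (¬ x' ≤ x ∧ ¬ x' ≤ y ∧ ¬ y' ≤ x ∧ ¬ y' ≤ y)

/-! ### The `m`-cover poset -/

/-- The tuple `(⊥, …, ⊥, p, …, p, q, …, q)` of length `m` with `l₀` entries `⊥`, then `l₁`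
entries `p`, and the remaining entries equal to `q`. -/
def mTuple {P : Type*} [PartialOrder P] [BoundedOrder P] (m l₀ l₁ : ℕ) (p q : P) : Fin m → P :=
  fun i => if (i : ℕ) < l₀ then ⊥ else if (i : ℕ) < l₀ + l₁ then p else q

/-- The `m`-cover poset of a bounded poset `P`: all `m`-tuples `(⊥^l₀, p^l₁, q^l₂)` with `p ⋖ q`
and `l₀ + l₁ + l₂ = m`, ordered componentwise. The constant tuple `⊥` is of this form as soon as
`P` has two elements; it is listed separately for the sake of the one-element poset. -/
abbrev MCover (P : Type*) [PartialOrder P] [BoundedOrder P] (m : ℕ) : Type _ :=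
  {x : Fin m → P // x = ⊥ ∨
    ∃ p q : P, p ⋖ q ∧ ∃ l₀ l₁ l₂ : ℕ, l₀ + l₁ + l₂ = m ∧ x = mTuple m l₀ l₁ p q}

/-! ### Northeast paths and path posets -/

/-- The two kinds of steps of a northeast path. -/
inductive NEStep where
  | north : NEStep
  | east : NEStep

/-- A northeast path, encoded by its word in the letters north and east. -/
abbrev NEPath : Type := List NEStep

/-- For a position `j` (counted from `0`) carrying an east-step, the position at which the maximal
block of consecutive east-steps around `j` starts. -/
def NEPath.blockStart (w : NEPath) : ℕ → ℕ
  | 0 => 0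
  | j + 1 =>
    match w[j]? with
    | some NEStep.east => NEPath.blockStart w j
    | _ => j + 1

/-- The relation generating the path order: a north-step is covered by the next north-step, and
an east-step is covered by the north-step immediately before its block of east-steps, if any. -/
inductive NEPath.StepCov (w : NEPath) : Fin w.length → Fin w.length → Prop
  | north {i j : Fin w.length} (hij : i < j) (hi : w.get i = NEStep.north)
      (hj : w.get j = NEStep.north)
      (hs : ∀ s, i < s → s < j → w.get s ≠ NEStep.north) : NEPath.StepCov w i j
  | east {j i : Fin w.length} (hj : w.get j = NEStep.east) (hi : w.get i = NEStep.north)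
      (h : NEPath.blockStart w j = i + 1) : NEPath.StepCov w j i

/-- The path order on the (positions of the) letters of `w`. -/
def NEPath.StepLE (w : NEPath) : Fin w.length → Fin w.length → Prop :=
  Relation.ReflTransGen (NEPath.StepCov w)

/-- The ground set of the path poset of `P` and `w`: the disjoint union of `P` and the letters
of `w`. -/
inductive PathPoset (P : Type*) (w : NEPath) where
  | base (p : P) : PathPoset P w
  | step (j : Fin w.length) : PathPoset P w

/-- The order of the path poset. -/
def PathPoset.le {P : Type*} [PartialOrder P] [BoundedOrder P] {w : NEPath} :
    PathPoset P w → PathPoset P w → Prop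
  | .base p, .base q => p ≤ q
  | .step i, .step j => NEPath.StepLE w i j
  | .base p, .step j =>
      (p = ⊥ ∧ w.get j = NEStep.east) ∨ w.get j = NEStep.north
  | .step _, .base _ => False

/-- Auxiliary rank function, used for antisymmetry of the path order. -/
def NEPath.rank (w : NEPath) (i : Fin w.length) : ℕ :=
  match w.get i with
  | .north => i + 1
  | .east => 0

theorem NEPath.StepCov.rank_lt {w : NEPath} {i j : Fin w.length} (h : NEPath.StepCov w i j) :
    w.rank i < w.rank j := by
  cases h with
  | north hij hi hj _ => simp only [NEPath.rank, hi, hj]; omega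
  | east hj hi _ => simp only [NEPath.rank, hi, hj]; omega

theorem NEPath.StepLE.eq_or_rank_lt {w : NEPath} {i j : Fin w.length}
    (h : NEPath.StepLE w i j) : i = j ∨ w.rank i < w.rank j := by
  unfold NEPath.StepLE at h
  induction h with
  | refl => exact Or.inl rfl
  | tail _ hc ih =>
    rcases ih with rfl | ih
    · exact Or.inr hc.rank_lt
    · exact Or.inr (ih.trans hc.rank_lt)

theorem NEPath.StepLE.north {w : NEPath} {i j : Fin w.length} (h : NEPath.StepLE w i j) :
    i = j ∨ w.get j = NEStep.north := by
  unfold NEPath.StepLE at h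
  cases h with
  | refl => exact Or.inl rfl
  | tail _ hc =>
    cases hc with
    | north _ _ hj _ => exact Or.inr hj
    | east _ hi _ => exact Or.inr hi

instance {P : Type*} [PartialOrder P] [BoundedOrder P] (w : NEPath) :
    PartialOrder (PathPoset P w) where
  le := PathPoset.le
  le_refl x := by
    cases x with
    | base p => exact le_refl p
    | step j => exact Relation.ReflTransGen.refl
  le_trans x y z hxy hyz := by
    cases x <;> cases y <;> cases z <;> simp only [PathPoset.le] at hxy hyz ⊢
    · exact le_trans hxy hyz
    · rcases hyz with ⟨rfl, h⟩ | h
      · exact Or.inl ⟨le_bot_iff.mp hxy, h⟩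
      · exact Or.inr h
    · rcases hyz.north with rfl | h
      · exact hxy
      · exact Or.inr h
    · exact Relation.ReflTransGen.trans hxy hyz
  le_antisymm x y hxy hyx := by
    cases x <;> cases y <;> simp only [PathPoset.le] at hxy hyx
    · rw [le_antisymm hxy hyx]
    · rcases hxy.eq_or_rank_lt with rfl | h
      · rfl
      · rcases hyx.eq_or_rank_lt with rfl | h'
        · rfl
        · omega

/-! ### The posets `P_{k,l}` -/

/-- The antichain with `l` elements. -/
structure AntichainPoset (l : ℕ) where
  /-- the index of an element -/
  idx : Fin l

instance (l : ℕ) : PartialOrder (AntichainPoset l) where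
  le a b := a = b
  le_refl _ := rfl
  le_trans _ _ _ h h' := h.trans h'
  le_antisymm _ _ h _ := h

/-- The bounded poset whose proper part is the disjoint union of a `k`-chain and an `l`-antichain
(`⊕` carries the order in which elements of different summands are incomparable). -/
abbrev ChainAntichain (k l : ℕ) : Type := WithBot (WithTop (Fin k ⊕ AntichainPoset l))

end CoverPoset

/-!
If `P^⟨2⟩` is a lattice, then every nonzero element `p` of `P` has at most one upper cover: for two
upper covers `q`, `q'`, the join `(c, d)` of `(p, q)` and `(p, q')` would satisfy `q, q' ≤ c < d`,
although `(c, c)` is then an upper bound as well. Hence the elements above a given nonzero element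
form a chain, and `P` is `2+2`-free if and only if its elements other than `⊥` and the atoms, here
called high, form a chain. In a path poset over `P_{0,0}` the high elements are the north-steps, and
conversely a word is read off by inserting into the chain of high elements every other nonzero
element but one atom.

When the high elements form a chain, there is an atom `a` below all of them, and raising the
entries of `⊥` one at a time along a maximal chain of `P` through `a`, last entry first, gives a
maximal chain of left-modular elements of `P^⟨m⟩`. For such a chain `x₀ ⋖ x₁ ⋖ ⋯` of a lattice,
labeling a cover `y ⋖ z` by the least `i` with `z ≤ y ⊔ xᵢ` gives an EL-labeling. Finally, `P` is a
lower set of `P^⟨m⟩` through the last entry and so inherits an EL-labeling. If `y` is high and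
`⊥ ⋖ p ⋖ q ≤ y` starts the rising chain of `[⊥, y]`, then the rising chain of `[p, ⊤]` also starts
with `p ⋖ q` and becomes the rising chain of `P` when `⊥` is put in front. It passes through `y`, so
all high elements lie on one chain.
-/

namespace CoverPoset

/-! ### Saturated chains and their labels -/

section Chains

variable {P Λ : Type*} {x y z : P} {c : List P}

theorem edgeLabels_cons_cons (lab : P → P → Λ) (x y : P) (c : List P) :
    edgeLabels lab (x :: y :: c) = lab x y :: edgeLabels lab (y :: c) := rfl

theorem IsRising.tail [PartialOrder Λ] {lab : P → P → Λ} (h : IsRising lab (x :: y :: c)) :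
    IsRising lab (y :: c) := by
  unfold IsRising at h ⊢
  exact (edgeLabels_cons_cons lab x y c ▸ h).of_cons

theorem IsRising.head_le [PartialOrder Λ] {lab : P → P → Λ} (h : IsRising lab (x :: y :: c)) :
    ∀ l ∈ edgeLabels lab (x :: y :: c), lab x y ≤ l := by
  intro l hl
  rcases List.mem_cons.1 hl with rfl | hl
  · exact le_rfl
  · exact ((List.pairwise_cons.1 (List.IsChain.pairwise h)).1 l hl).le

variable [PartialOrder P]

theorem IsSaturatedChain.singleton (x : P) : IsSaturatedChain x x [x] := by
  simp [IsSaturatedChain]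

theorem IsSaturatedChain.exists_eq_cons (h : IsSaturatedChain x y c) : ∃ c', c = x :: c' :=
  List.head?_eq_some_iff.1 h.2.1

theorem IsSaturatedChain.cons (hxy : x ⋖ y) (h : IsSaturatedChain y z c) :
    IsSaturatedChain x z (x :: c) := by
  obtain ⟨c', rfl⟩ := h.exists_eq_cons
  exact ⟨List.isChain_cons_cons.2 ⟨hxy, h.1⟩, rfl, by simpa using h.2.2⟩

theorem IsSaturatedChain.cases (h : IsSaturatedChain x z c) :
    (x = z ∧ c = [x]) ∨ ∃ y c', x ⋖ y ∧ c = x :: y :: c' ∧ IsSaturatedChain y z (y :: c') := by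
  obtain ⟨c', rfl⟩ := h.exists_eq_cons
  cases c' with
  | nil => exact Or.inl ⟨by simpa using h.2.2, rfl⟩
  | cons y c'' =>
    have hchain := List.isChain_cons_cons.1 h.1
    exact Or.inr ⟨y, c'', hchain.1, rfl, hchain.2, rfl, by simpa using h.2.2⟩

theorem IsSaturatedChain.induction {motive : P → List P → Prop} (base : motive z [z])
    (step : ∀ x y c, x ⋖ y → IsSaturatedChain y z (y :: c) → motive y (y :: c) →
      motive x (x :: y :: c)) (h : IsSaturatedChain x z c) : motive x c := by
  induction c generalizing x with
  | nil => simp [IsSaturatedChain] at h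
  | cons a c ih =>
    rcases h.cases with ⟨rfl, h'⟩ | ⟨y, c', hxy, h', hc'⟩
    · exact h' ▸ base
    · obtain ⟨rfl, rfl⟩ := List.cons.inj h'
      exact step _ _ _ hxy hc' (ih hc')

theorem IsSaturatedChain.le (h : IsSaturatedChain x z c) : x ≤ z :=
  h.induction (motive := fun x _ => x ≤ z) le_rfl fun _ _ _ hxy _ ih => hxy.le.trans ih

theorem IsSaturatedChain.eq_singleton (h : IsSaturatedChain x x c) : c = [x] := by
  rcases h.cases with ⟨_, h'⟩ | ⟨y, c', hxy, _, hc'⟩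
  · exact h'
  · exact absurd hc'.le hxy.lt.not_ge

theorem IsSaturatedChain.isChain (h : IsSaturatedChain x z c) : IsChain (· ≤ ·) {y | y ∈ c} := by
  have hpw : c.Pairwise fun a b => a ≤ b ∨ b ≤ a :=
    (h.1.imp fun _ _ hab => hab.le).pairwise.imp Or.inl
  have : Std.Symm fun a b : P => a ≤ b ∨ b ≤ a := ⟨fun _ _ => Or.symm⟩
  exact fun a ha b hb => hpw.forall ha hb

theorem exists_isSaturatedChain_top [OrderTop P] [WellFoundedGT P] {S : Set P}
    (hS : ∀ x ∈ S, x ≠ ⊤ → ∃ y ∈ S, x ⋖ y) (hx : x ∈ S) :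
    ∃ c, IsSaturatedChain x ⊤ c ∧ ∀ y ∈ c, y ∈ S := by
  induction x using WellFoundedGT.induction with
  | ind x ih =>
    by_cases htop : x = ⊤
    · exact ⟨[x], htop ▸ .singleton x, by simpa using hx⟩
    · obtain ⟨y, hy, hxy⟩ := hS x hx htop
      obtain ⟨c, hc, hcS⟩ := ih y hxy.lt hy
      exact ⟨x :: c, hc.cons hxy, List.forall_mem_cons.2 ⟨hx, hcS⟩⟩

end Chains

theorem isELLabeling_of_first_atom {P Λ : Type*} [PartialOrder P] [WellFoundedGT P]
    [PartialOrder Λ] {lab : P → P → Λ}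
    (H : ∀ y z : P, y < z → ∃ u, y ⋖ u ∧ u ≤ z ∧
      (∀ v v', u ≤ v → v ⋖ v' → v' ≤ z → lab y u < lab v v') ∧
      (∀ u', y ⋖ u' → u' ≤ z → u' ≠ u → lab y u < lab y u') ∧
      (∀ c, IsSaturatedChain y z c → ∃ l ∈ edgeLabels lab c, ¬ lab y u < l)) :
    IsELLabeling lab := by
  intro y z hyz
  induction y using WellFoundedGT.induction with
  | ind y ih =>
    rcases hyz.eq_or_lt with rfl | hlt
    · exact ⟨[y], .singleton y, .nil, fun d hd _ => hd.eq_singleton,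
        fun d hd h => absurd hd.eq_singleton h⟩
    obtain ⟨u, hyu, huz, hrest, hatom, hbound⟩ := H y z hlt
    obtain ⟨c, hc, hrising, hunique, hlex⟩ := ih u hyu.lt huz
    refine ⟨y :: c, hc.cons hyu, ?_, fun d hd hdr => ?_, fun d hd hne => ?_⟩
    · rcases hc.cases with ⟨_, rfl⟩ | ⟨v, c', huv, rfl, hv⟩
      · exact .singleton _
      · exact List.isChain_cons_cons.2 ⟨hrest u v le_rfl huv hv.le, hrising⟩
    · rcases hd.cases with ⟨h, _⟩ | ⟨u', d', hu', rfl, hd'⟩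
      · exact absurd h hlt.ne
      obtain rfl | hne := eq_or_ne u' u
      · rw [hunique _ hd' hdr.tail]
      · obtain ⟨l, hl, hnot⟩ := hbound _ hd
        exact absurd ((hatom u' hu' hd'.le hne).trans_le (hdr.head_le l hl)) hnot
    · obtain ⟨c', rfl⟩ := hc.exists_eq_cons
      rcases hd.cases with ⟨h, _⟩ | ⟨u', d', hu', rfl, hd'⟩
      · exact absurd h hlt.ne
      rw [edgeLabels_cons_cons, edgeLabels_cons_cons]
      obtain rfl | hu := eq_or_ne u' u
      · exact .cons (hlex _ hd' fun h => hne (by rw [h]))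
      · exact .rel (hatom u' hu' hd'.le hu)

/-! ### Left-modular lattices are EL-shellable -/

section LeftModular

variable {L : Type*} [Lattice L]

theorem IsLeftModularElem.le {p q q' : L} (hp : IsLeftModularElem p) (h : q ≤ q') :
    (q ⊔ p) ⊓ q' ≤ q ⊔ (p ⊓ q') := by
  rcases h.eq_or_lt with rfl | h
  · exact inf_le_right.trans le_sup_left
  · exact (hp q q' h).le

theorem IsLeftModularElem.inf_le_iff {p v v' : L} (hp : IsLeftModularElem p) (h : v ⋖ v') :
    p ⊓ v' ≤ v ↔ ¬ v' ≤ v ⊔ p := by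
  constructor
  · intro hinf hsup
    have hmod := hp v v' h.lt
    rw [inf_eq_right.2 hsup, sup_eq_left.2 hinf] at hmod
    exact h.lt.ne' hmod
  · intro hsup
    by_contra hinf
    rcases h.eq_or_eq (c := v ⊔ (p ⊓ v')) le_sup_left (sup_le h.le inf_le_right) with heq | heq
    · exact hinf (sup_eq_left.1 heq)
    · exact hsup (heq.ge.trans (sup_le_sup_left inf_le_left _))

theorem wcovBy_sup_inf {p p' y z : L} (hp : IsLeftModularElem p) (hp' : IsLeftModularElem p')
    (h : p ⩿ p') (hyz : y ≤ z) : y ⊔ (p ⊓ z) ⩿ y ⊔ (p' ⊓ z) := by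
  refine wcovBy_of_eq_or_eq (sup_le_sup_left (inf_le_inf_right _ h.le) _) fun w hlow hupp => ?_
  have hyw : y ≤ w := le_sup_left.trans hlow
  have hwz : w ≤ z := hupp.trans (sup_le hyz inf_le_right)
  rcases h.eq_or_eq (c := p ⊔ (w ⊓ p')) le_sup_left (sup_le h.le inf_le_right) with heq | heq
  · have hw : p' ⊓ w ≤ p := inf_comm p' w ▸ sup_eq_left.1 heq
    refine Or.inl (le_antisymm ?_ hlow)
    calc w ≤ (y ⊔ p') ⊓ w := le_inf (hupp.trans (sup_le_sup_left inf_le_left _)) le_rfl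
      _ ≤ y ⊔ (p' ⊓ w) := hp'.le hyw
      _ ≤ y ⊔ (p ⊓ z) := sup_le_sup_left (le_inf hw (inf_le_right.trans hwz)) _
  · have hw : p' ≤ w ⊔ p :=
      heq.ge.trans (sup_le le_sup_right (inf_le_left.trans le_sup_left))
    refine Or.inr (le_antisymm hupp ?_)
    calc y ⊔ (p' ⊓ z) ≤ (w ⊔ p) ⊓ z :=
          sup_le (le_inf (hyw.trans le_sup_left) hyz) (inf_le_inf_right _ hw)
      _ ≤ w ⊔ (p ⊓ z) := hp.le hwz
      _ ≤ w := sup_le le_rfl (le_sup_right.trans hlow)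

/-- A saturated maximal chain of left-modular elements, written as a sequence that may repeat
elements and is eventually constant with value the greatest element. -/
structure IsLeftModularSeq (X : ℕ → L) : Prop where
  isBot_zero : IsBot (X 0)
  exists_isTop : ∃ n, IsTop (X n)
  wcovBy_succ : ∀ i, X i ⩿ X (i + 1)
  isLeftModularElem : ∀ i, IsLeftModularElem (X i)

theorem IsSaturatedChain.exists_isLeftModularSeq {x z : L} {c : List L}
    (hx : IsBot x) (hz : IsTop z) (h : IsSaturatedChain x z c)
    (hc : ∀ p ∈ c, IsLeftModularElem p) : ∃ X : ℕ → L, IsLeftModularSeq X := by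
  obtain ⟨X, hX, ⟨n, hn⟩, hcov, hmem⟩ :
      ∃ X : ℕ → L, X 0 = x ∧ (∃ n, X n = z) ∧ (∀ i, X i ⩿ X (i + 1)) ∧ ∀ i, X i ∈ c := by
    refine h.induction (motive := fun x c => ∃ X : ℕ → L, X 0 = x ∧ (∃ n, X n = z) ∧
      (∀ i, X i ⩿ X (i + 1)) ∧ ∀ i, X i ∈ c)
      ⟨fun _ => z, rfl, ⟨0, rfl⟩, fun _ => WCovBy.rfl, by simp⟩ ?_
    rintro x y c hxy - ⟨X, hX, ⟨n, hn⟩, hcov, hmem⟩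
    refine ⟨fun i => i.casesOn x X, rfl, ⟨n + 1, hn⟩, ?_, ?_⟩
    · rintro (_ | i)
      exacts [(hX ▸ hxy.wcovBy : x ⩿ X 0), hcov i]
    · rintro (_ | i)
      exacts [List.mem_cons_self, List.mem_cons_of_mem _ (hmem i)]
  exact ⟨X, hX ▸ hx, ⟨n, hn ▸ hz⟩, hcov, fun i => hc _ (hmem i)⟩

/-- Liu's labeling of a lattice with a maximal chain `X 0 ⩿ X 1 ⩿ ⋯` of left-modular elements. -/
noncomputable def seqLabel (X : ℕ → L) (y z : L) : ℕ := sInf {i | z ≤ y ⊔ X i}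

namespace IsLeftModularSeq

variable {X : ℕ → L} {v v' x y z : L} {j : ℕ}

theorem seqLabel_le_iff (hX : IsLeftModularSeq X) : seqLabel X y z ≤ j ↔ z ≤ y ⊔ X j := by
  obtain ⟨n, hn⟩ := hX.exists_isTop
  have hmono : Monotone X := monotone_nat_of_le_succ fun i => (hX.wcovBy_succ i).le
  have hne : {i | z ≤ y ⊔ X i}.Nonempty := ⟨n, (hn z).trans le_sup_right⟩
  exact ⟨fun h => (Nat.sInf_mem hne).trans (sup_le_sup_left (hmono h) _), fun h => Nat.sInf_le h⟩

theorem lt_seqLabel_iff (hX : IsLeftModularSeq X) (h : v ⋖ v') :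
    j < seqLabel X v v' ↔ X j ⊓ v' ≤ v := by
  rw [(hX.isLeftModularElem j).inf_le_iff h, ← hX.seqLabel_le_iff, not_le]

theorem exists_covBy_sup_inf (hX : IsLeftModularSeq X) (h : y < z) :
    ∃ j, y ⋖ y ⊔ (X (j + 1) ⊓ z) := by
  classical
  obtain ⟨n, hn⟩ := hX.exists_isTop
  have hex : ∃ i, ¬ X i ⊓ z ≤ y := ⟨n, fun h' => h.not_ge ((le_inf (hn z) le_rfl).trans h')⟩
  obtain ⟨j, hj⟩ : ∃ j, Nat.find hex = j + 1 := Nat.exists_eq_succ_of_ne_zero fun h0 =>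
    Nat.find_spec hex (inf_le_left.trans (h0 ▸ hX.isBot_zero y))
  have hbelow : X j ⊓ z ≤ y := not_not.1 (Nat.find_min hex (hj ▸ Nat.lt_succ_self j))
  have hwcov := wcovBy_sup_inf (hX.isLeftModularElem j) (hX.isLeftModularElem (j + 1))
    (hX.wcovBy_succ j) h.le
  rw [sup_eq_left.2 hbelow] at hwcov
  exact ⟨j, hwcov.covBy_of_ne fun heq => (hj ▸ Nat.find_spec hex) (sup_eq_left.1 heq.symm)⟩

theorem inf_le_of_forall_lt_label (hX : IsLeftModularSeq X) {c : List L}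
    (hc : IsSaturatedChain x z c) (h : ∀ l ∈ edgeLabels (seqLabel X) c, j < l) :
    X j ⊓ z ≤ x := by
  refine hc.induction (motive := fun x c => (∀ l ∈ edgeLabels (seqLabel X) c, j < l) →
    X j ⊓ z ≤ x) (fun _ => inf_le_right) (fun x v c hxv _ ih hl => ?_) h
  obtain ⟨hfirst, hrest⟩ := List.forall_mem_cons.1 hl
  exact (le_inf inf_le_left (ih hrest)).trans ((hX.lt_seqLabel_iff hxv).1 hfirst)

theorem isELLabeling_seqLabel [WellFoundedGT L] (hX : IsLeftModularSeq X) :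
    IsELLabeling (seqLabel X) := by
  refine isELLabeling_of_first_atom fun y z hyz => ?_
  obtain ⟨j, hcov⟩ := hX.exists_covBy_sup_inf hyz
  have hlabel : seqLabel X y (y ⊔ (X (j + 1) ⊓ z)) ≤ j + 1 :=
    hX.seqLabel_le_iff.2 (sup_le_sup_left inf_le_left _)
  refine ⟨_, hcov, sup_le hyz.le inf_le_right, fun v v' huv hv hz => ?_,
    fun u hu huz hne => ?_, fun c hc => ?_⟩
  · refine hlabel.trans_lt ((hX.lt_seqLabel_iff hv).2 ?_)
    exact (inf_le_inf_left _ hz).trans (le_sup_right.trans huv)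
  · refine hlabel.trans_lt (not_le.1 fun hle => ?_)
    have hu' : u ≤ y ⊔ (X (j + 1) ⊓ z) :=
      (le_inf (hX.seqLabel_le_iff.1 hle) huz).trans ((hX.isLeftModularElem _).le hyz.le)
    exact (hcov.eq_or_eq hu.le hu').elim hu.lt.ne' hne
  · by_contra! hlt
    have hu : y ⊔ (X (j + 1) ⊓ z) ≤ y := calc
      _ ≤ (y ⊔ X (seqLabel X y (y ⊔ (X (j + 1) ⊓ z)))) ⊓ z :=
        le_inf (hX.seqLabel_le_iff.1 le_rfl) (sup_le hyz.le inf_le_right)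
      _ ≤ y ⊔ (X (seqLabel X y (y ⊔ (X (j + 1) ⊓ z))) ⊓ z) := (hX.isLeftModularElem _).le hyz.le
      _ ≤ y := sup_le le_rfl (hX.inf_le_of_forall_lt_label hc hlt)
    exact hcov.lt.not_ge hu

end IsLeftModularSeq

end LeftModular

theorem IsLeftModularLattice.isELShellable {P : Type*} [PartialOrder P] [WellFoundedGT P]
    (h : IsLeftModularLattice P) : IsELShellable P := by
  obtain ⟨hL, bot, top, c, hbot, htop, hc, hlm⟩ := h
  let := hL.toLattice
  obtain ⟨X, hX⟩ := hc.exists_isLeftModularSeq hbot htop hlm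
  exact ⟨⟨bot, hbot⟩, ⟨top, htop⟩, ℕ, inferInstance, _, hX.isELLabeling_seqLabel⟩

/-! ### The `m`-cover poset -/

section MCover

variable {P : Type*} [PartialOrder P] [BoundedOrder P] {m : ℕ} {p q : P}

theorem exists_forall_mem_iff_lt_of_isLowerSet {A : Set (Fin m)} (hA : IsLowerSet A) :
    ∃ l ≤ m, ∀ i : Fin m, i ∈ A ↔ (i : ℕ) < l := by
  rcases hA.eq_univ_or_Iio with rfl | ⟨a, rfl⟩
  · exact ⟨m, le_rfl, fun i => by simp⟩
  · exact ⟨a, a.2.le, fun i => Iff.rfl⟩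

theorem mTuple_eq_bot_or_wcovBy (h : p ⩿ q) (l₀ l₁ : ℕ) {i j : Fin m} (hij : i ≤ j) :
    mTuple m l₀ l₁ p q i = ⊥ ∨ mTuple m l₀ l₁ p q i ⩿ mTuple m l₀ l₁ p q j := by
  unfold mTuple
  by_cases hi : (i : ℕ) < l₀
  · exact Or.inl (if_pos hi)
  · right
    split_ifs <;> first | omega | exact WCovBy.rfl

theorem exists_eq_mTuple {f : Fin m → P} (hf : Monotone f) (hpq : p ≤ q)
    (hfpq : ∀ i, f i = ⊥ ∨ f i = p ∨ f i = q) :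
    ∃ l₀ l₁ l₂, l₀ + l₁ + l₂ = m ∧ f = mTuple m l₀ l₁ p q := by
  obtain ⟨l₀, hl₀m, hl₀⟩ := exists_forall_mem_iff_lt_of_isLowerSet (A := {i | f i = ⊥})
    fun j i hij hj => le_bot_iff.1 ((hf hij).trans hj.le)
  obtain ⟨l, hlm, hl⟩ := exists_forall_mem_iff_lt_of_isLowerSet (A := {i | f i ≤ p})
    fun j i hij hj => (hf hij).trans hj
  have hl₀l : l₀ ≤ l := by
    by_contra! hlt
    have hbot : f ⟨l, hlt.trans_le hl₀m⟩ = ⊥ := (hl₀ _).2 hlt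
    exact lt_irrefl l ((hl _).1 (hbot.trans_le bot_le))
  refine ⟨l₀, l - l₀, m - l, by omega, funext fun i => ?_⟩
  unfold mTuple
  split_ifs with h₀ h₁
  · exact (hl₀ i).2 h₀
  · have hfp : f i ≤ p := (hl i).2 (by omega)
    rcases hfpq i with hi | hi | hi
    · exact absurd ((hl₀ i).1 hi) h₀
    · exact hi
    · exact le_antisymm hfp (hpq.trans hi.ge)
  · have hfp : ¬ f i ≤ p := fun h => h₁ (by have := (hl i).1 h; omega)
    rcases hfpq i with hi | hi | hi
    · exact absurd (hi.trans_le bot_le) hfp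
    · exact absurd hi.le hfp
    · exact hi

theorem monotone_of_forall_eq_bot_or_wcovBy {f : Fin m → P}
    (h : ∀ i j, i ≤ j → f i = ⊥ ∨ f i ⩿ f j) : Monotone f := fun i j hij =>
  (h i j hij).elim (fun hi => hi.trans_le bot_le) WCovBy.le

theorem exists_covBy_forall_eq [IsStronglyCoatomic P] {f : Fin m → P}
    (h : ∀ i j, i ≤ j → f i = ⊥ ∨ f i ⩿ f j) (hf : f ≠ ⊥) :
    ∃ p q, p ⋖ q ∧ ∀ i, f i = ⊥ ∨ f i = p ∨ f i = q := by
  have hmono := monotone_of_forall_eq_bot_or_wcovBy h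
  obtain ⟨i₀, hi₀⟩ : ∃ i, f i ≠ ⊥ := Function.ne_iff.1 hf
  have : NeZero m := .of_pos i₀.pos
  have hcov : ∀ i, f i ≠ ⊥ → f i ≠ f ⊤ → f i ⋖ f ⊤ := fun i hi hi' =>
    ((h i ⊤ le_top).resolve_left hi).covBy_of_ne hi'
  by_cases hex : ∃ i, f i ≠ ⊥ ∧ f i ≠ f ⊤
  · obtain ⟨i, hi, hi'⟩ := hex
    refine ⟨f i, f ⊤, hcov i hi hi', fun j => ?_⟩
    by_contra! hj
    obtain ⟨hj, hji, hj'⟩ := hj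
    rcases le_total i j with hij | hij
    · exact ((hcov i hi hi').eq_or_eq (hmono hij) (hmono le_top)).elim hji hj'
    · exact ((hcov j hj hj').eq_or_eq (hmono hij) (hmono le_top)).elim hji.symm hi'
  · push Not at hex
    have htop : ⊥ < f ⊤ := (bot_lt_iff_ne_bot.2 hi₀).trans_le (hmono le_top)
    obtain ⟨p, -, hp⟩ := exists_le_covBy_of_lt htop
    exact ⟨p, f ⊤, hp, fun i => (eq_or_ne (f i) ⊥).imp_right fun hi => Or.inr (hex i hi)⟩

theorem mem_mCover_iff [IsStronglyCoatomic P] {f : Fin m → P} :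
    (f = ⊥ ∨ ∃ p q : P, p ⋖ q ∧ ∃ l₀ l₁ l₂ : ℕ, l₀ + l₁ + l₂ = m ∧ f = mTuple m l₀ l₁ p q) ↔
      ∀ i j, i ≤ j → f i = ⊥ ∨ f i ⩿ f j := by
  constructor
  · rintro (rfl | ⟨p, q, hpq, l₀, l₁, l₂, -, rfl⟩) i j hij
    · exact Or.inl rfl
    · exact mTuple_eq_bot_or_wcovBy hpq.wcovBy l₀ l₁ hij
  · refine fun h => or_iff_not_imp_left.2 fun hf => ?_
    obtain ⟨p, q, hpq, hfpq⟩ := exists_covBy_forall_eq h hf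
    exact ⟨p, q, hpq, exists_eq_mTuple (monotone_of_forall_eq_bot_or_wcovBy h) hpq.le hfpq⟩

variable [IsStronglyCoatomic P]

/-- The element of the `m`-cover poset with entries `f i`, the entries being described by pairs
as in `mem_mCover_iff`. -/
def MCover.mk (f : Fin m → P) (h : ∀ i j, i ≤ j → f i = ⊥ ∨ f i ⩿ f j) : MCover P m :=
  ⟨f, mem_mCover_iff.2 h⟩

theorem MCover.eq_bot_or_wcovBy (x : MCover P m) {i j : Fin m} (hij : i ≤ j) :
    x.1 i = ⊥ ∨ x.1 i ⩿ x.1 j :=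
  mem_mCover_iff.1 x.2 i j hij

theorem MCover.wcovBy (x : MCover P m) {i j : Fin m} (hij : i ≤ j) (h : x.1 i ≠ ⊥) :
    x.1 i ⩿ x.1 j :=
  (x.eq_bot_or_wcovBy hij).resolve_left h

theorem MCover.monotone (x : MCover P m) : Monotone x.1 :=
  monotone_of_forall_eq_bot_or_wcovBy (mem_mCover_iff.1 x.2)

instance (m : ℕ) : BoundedOrder (MCover P m) where
  bot := ⟨⊥, Or.inl rfl⟩
  bot_le _ _ := bot_le
  top := .mk ⊤ fun _ _ _ => Or.inr WCovBy.rfl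
  le_top _ _ := le_top

/-- The embedding of `P` into its `m`-cover poset which places an element at the last entry. -/
def lastEmbedding (P : Type*) [PartialOrder P] [BoundedOrder P] [IsStronglyCoatomic P] (m : ℕ)
    [NeZero m] : P ↪o MCover P m :=
  .ofMapLEIff
    (fun x => .mk (Function.update ⊥ ⊤ x) fun i j hij => by
      obtain rfl | hi := eq_or_ne i ⊤
      · exact Or.inr (top_le_iff.1 hij ▸ WCovBy.rfl)
      · exact Or.inl (by simp only [Function.update_of_ne hi, Pi.bot_apply]))
    fun _ _ => update_le_update_iff'

theorem isLowerSet_range_lastEmbedding (m : ℕ) [NeZero m] :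
    IsLowerSet (Set.range (lastEmbedding P m)) := by
  rintro _ y hy ⟨x, rfl⟩
  refine ⟨y.1 ⊤, Subtype.ext (Function.update_eq_iff.2 ⟨rfl, fun i hi => ?_⟩)⟩
  have hbot : (lastEmbedding P m x).1 i = ⊥ := by
    simp [lastEmbedding, MCover.mk, Function.update_of_ne hi]
  exact (le_bot_iff.1 ((hy i).trans_eq hbot)).symm

end MCover

theorem IsLatticePoset.of_isLowerSet {P Q : Type*} [PartialOrder P] [OrderTop P] [PartialOrder Q]
    {f : P ↪o Q} (hf : IsLowerSet (Set.range f)) (h : IsLatticePoset Q) : IsLatticePoset P := by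
  intro p q
  obtain ⟨⟨j, hj⟩, i, hi⟩ := h (f p) (f q)
  rw [← Set.image_pair] at hj hi
  constructor
  · obtain ⟨j, rfl⟩ := hf (hj.2 (f.monotone.mem_upperBounds_image fun _ _ => le_top)) ⟨⊤, rfl⟩
    exact ⟨j, IsLUB.of_image f.le_iff_le hj⟩
  · obtain ⟨i, rfl⟩ := hf (hi.1 ⟨p, by simp⟩) ⟨p, rfl⟩
    exact ⟨i, IsGLB.of_image f.le_iff_le hi⟩

/-! ### Posets that are trees above the least element -/

/-- Removing the least element leaves a forest: every nonzero element has at most one upper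
cover. -/
def IsTreeLike (P : Type*) [PartialOrder P] [OrderBot P] : Prop :=
  ∀ ⦃p q q' : P⦄, p ≠ ⊥ → p ⋖ q → p ⋖ q' → q = q'

/-- An element above some nonzero element; in terms of the covers of `⊥`, neither `⊥` nor an
atom. -/
def IsHigh {P : Type*} [PartialOrder P] [OrderBot P] (y : P) : Prop :=
  ∃ x, x ≠ ⊥ ∧ x < y

section Tree

variable {P : Type*} [PartialOrder P]

theorem isTreeLike_of_isLatticePoset_mCover_two [BoundedOrder P] [IsStronglyCoatomic P]
    (h : IsLatticePoset (MCover P 2)) : IsTreeLike P := by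
  have hmem : ∀ {c d : P}, c ⩿ d → ∀ i j, i ≤ j → ![c, d] i = ⊥ ∨ ![c, d] i ⩿ ![c, d] j := by
    intro c d hcd i j hij
    fin_cases i <;> fin_cases j
    exacts [Or.inr WCovBy.rfl, Or.inr hcd, absurd hij (by decide), Or.inr WCovBy.rfl]
  intro p q q' hp hq hq'
  obtain ⟨J, hJ⟩ := (h (.mk _ (hmem hq.wcovBy)) (.mk _ (hmem hq'.wcovBy))).1
  have hqJ := hJ.1 (Set.mem_insert _ _)
  have hqJ' := hJ.1 (Set.mem_insert_of_mem _ rfl)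
  have hmin : ∀ c d, c ⩿ d → p ≤ c → q ≤ d → q' ≤ d → J.1 0 ≤ c ∧ J.1 1 ≤ d := by
    intro c d hcd hpc hqd hqd'
    have hle : J ≤ .mk _ (hmem hcd) := hJ.2 <| by
      rintro _ (rfl | rfl) i <;> fin_cases i <;> assumption
    exact ⟨hle 0, hle 1⟩
  have hJcov : J.1 0 ⩿ J.1 1 := J.wcovBy zero_le_one fun h0 => hp (le_bot_iff.1 (h0 ▸ hqJ 0))
  have hstep : ∀ r r', p ⋖ r → p ⋖ r' → r ≠ r' → r ≤ J.1 1 → r' ≤ J.1 1 →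
      r ≤ J.1 0 ∧ J.1 0 < J.1 1 := by
    intro r r' hr hr' hne hrJ hrJ'
    have hlt : r < J.1 1 := hrJ.lt_of_ne fun heq =>
      (hr.eq_or_eq hr'.le (hrJ'.trans_eq heq.symm)).elim hr'.lt.ne' hne.symm
    obtain ⟨c, hrc, hcJ⟩ := exists_le_covBy_of_lt hlt
    have hJc : J.1 0 ≤ c := (hmin c _ hcJ.wcovBy (hr.le.trans hrc) (hqJ 1) (hqJ' 1)).1
    obtain rfl : c = J.1 0 := (hJcov.eq_or_eq hJc hcJ.le).resolve_right hcJ.lt.ne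
    exact ⟨hrc, hcJ.lt⟩
  by_contra hne
  obtain ⟨hq0, hlt⟩ := hstep q q' hq hq' hne (hqJ 1) (hqJ' 1)
  obtain ⟨hq0', -⟩ := hstep q' q hq' hq (Ne.symm hne) (hqJ' 1) (hqJ 1)
  exact hlt.not_ge (hmin _ _ WCovBy.rfl (hqJ 0) hq0 hq0').2

section OrderBot

variable [OrderBot P] {x y z : P}

theorem IsHigh.ne_bot (h : IsHigh y) : y ≠ ⊥ := by
  obtain ⟨x, -, hxy⟩ := h
  exact hxy.ne_bot

theorem IsHigh.mono (h : IsHigh y) (hyz : y ≤ z) : IsHigh z :=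
  h.imp fun _ hx => ⟨hx.1, hx.2.trans_le hyz⟩

theorem isTwoPlusTwoFree_of_isChain (h : IsChain (· ≤ ·) {y : P | IsHigh y}) :
    IsTwoPlusTwoFree P := by
  rintro ⟨x, y, x', y', hxy, hxy', ⟨hxx', -, -, hyy'⟩, hx'x, -, -, hy'y⟩
  have hy : IsHigh y := ⟨x, fun hx => hxx' (hx ▸ bot_le), hxy⟩
  have hy' : IsHigh y' := ⟨x', fun hx' => hx'x (hx' ▸ bot_le), hxy'⟩
  exact (h.total hy hy').elim hyy' hy'y

namespace IsTreeLike

theorem total [WellFoundedGT P] [IsStronglyAtomic P] (hT : IsTreeLike P) (hx : x ≠ ⊥)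
    (hy : x ≤ y) (hz : x ≤ z) : y ≤ z ∨ z ≤ y := by
  induction x using WellFoundedGT.induction with
  | ind x ih =>
    rcases hy.eq_or_lt with rfl | hy
    · exact Or.inl hz
    rcases hz.eq_or_lt with rfl | hz
    · exact Or.inr hy.le
    obtain ⟨u, hxu, huy⟩ := exists_covBy_le_of_lt hy
    obtain ⟨v, hxv, hvz⟩ := exists_covBy_le_of_lt hz
    obtain rfl := hT hx hxu hxv
    exact ih u hxu.lt hxu.lt.ne_bot huy hvz

theorem le_of_wcovBy [IsStronglyAtomic P] (hT : IsTreeLike P) (hx : x ≠ ⊥) (hy : x ⩿ y)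
    (hz : x < z) : y ≤ z := by
  rcases wcovBy_iff_covBy_or_eq.1 hy with hy | rfl
  · obtain ⟨u, hxu, huz⟩ := exists_covBy_le_of_lt hz
    exact hT hx hy hxu ▸ huz
  · exact hz.le

theorem mem_of_isSaturatedChain [IsStronglyAtomic P] (hT : IsTreeLike P) {c : List P}
    (hx : x ≠ ⊥) (hc : IsSaturatedChain x z c) (hxy : x ≤ y) (hyz : y ≤ z) : y ∈ c := by
  refine hc.induction (motive := fun x c => x ≠ ⊥ → x ≤ y → y ∈ c)
    (fun _ h => by simp [le_antisymm hyz h]) (fun x v d hxv _ ih hx hxy => ?_) hx hxy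
  rcases hxy.eq_or_lt with rfl | hlt
  · exact List.mem_cons_self
  · exact List.mem_cons_of_mem _ (ih hxv.lt.ne_bot (hT.le_of_wcovBy hx hxv.wcovBy hlt))

theorem isTwoPlusTwoFree_iff [WellFoundedGT P] [IsStronglyAtomic P] (hT : IsTreeLike P) :
    IsTwoPlusTwoFree P ↔ IsChain (· ≤ ·) {y : P | IsHigh y} := by
  refine ⟨?_, isTwoPlusTwoFree_of_isChain⟩
  rintro h y ⟨x, hx, hxy⟩ y' ⟨x', hx', hxy'⟩ -
  by_contra! hc
  refine h ⟨x, y, x', y', hxy, hxy', ⟨fun h' => ?_, fun h' => ?_, fun h' => ?_, hc.1⟩,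
    fun h' => ?_, fun h' => ?_, fun h' => ?_, hc.2⟩
  · exact (hT.total hx hxy.le (h'.trans hxy'.le)).elim hc.1 hc.2
  · exact (hT.total hx hxy.le h').elim hc.1 hc.2
  · exact hc.1 (h'.trans hxy'.le)
  · exact (hT.total hx' (h'.trans hxy.le) hxy'.le).elim hc.1 hc.2
  · exact (hT.total hx' h' hxy'.le).elim hc.1 hc.2
  · exact hc.2 (h'.trans hxy.le)

end IsTreeLike

end OrderBot

end Tree

/-! ### EL-labelings of tree-like posets -/

section EL

theorem edgeLabels_map {P Q Λ : Type*} (f : P → Q) (lab : Q → Q → Λ) (c : List P) :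
    edgeLabels lab (c.map f) = edgeLabels (fun p q => lab (f p) (f q)) c := by
  simp only [edgeLabels, ← List.map_tail, List.zipWith_map]

theorem isRising_map {P Q Λ : Type*} [PartialOrder Λ] {f : P → Q} {lab : Q → Q → Λ} {c : List P} :
    IsRising lab (c.map f) ↔ IsRising (fun p q => lab (f p) (f q)) c := by
  rw [IsRising, IsRising, edgeLabels_map]

variable {P Q Λ : Type*} [PartialOrder P] [PartialOrder Q] [PartialOrder Λ] {f : P ↪o Q} {x y : P}

theorem covBy_apply_iff_of_isLowerSet (hf : IsLowerSet (Set.range f)) : f x ⋖ f y ↔ x ⋖ y :=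
  ⟨fun h => h.of_image f, fun h => h.image f hf.ordConnected⟩

theorem isSaturatedChain_map_iff (hf : IsLowerSet (Set.range f)) {c : List P} :
    IsSaturatedChain (f x) (f y) (c.map f) ↔ IsSaturatedChain x y c := by
  simp [IsSaturatedChain, List.isChain_map, covBy_apply_iff_of_isLowerSet hf, List.getLast?_map]

theorem IsSaturatedChain.exists_map_eq (hf : IsLowerSet (Set.range f)) {a : Q} {c : List Q}
    (hc : IsSaturatedChain a (f y) c) : ∃ d : List P, c = d.map f := by
  refine hc.induction (motive := fun _ c => ∃ d : List P, c = d.map f) ⟨[y], rfl⟩ ?_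
  rintro x z e hxz hs ⟨d, hd⟩
  obtain ⟨x', rfl⟩ := hf (hxz.le.trans hs.le) ⟨y, rfl⟩
  exact ⟨x' :: d, by rw [hd, List.map_cons]⟩

theorem IsELLabeling.comp {lab : Q → Q → Λ} (h : IsELLabeling lab)
    (hf : IsLowerSet (Set.range f)) : IsELLabeling (fun p q => lab (f p) (f q)) := by
  intro x y hxy
  obtain ⟨c, hc, hrising, hunique, hlex⟩ := h (f x) (f y) (f.le_iff_le.2 hxy)
  obtain ⟨d, rfl⟩ := hc.exists_map_eq hf
  have hinj := List.map_injective_iff.2 f.injective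
  refine ⟨d, (isSaturatedChain_map_iff hf).1 hc, isRising_map.1 hrising, fun e he her => ?_,
    fun e he hne => ?_⟩
  · exact hinj (hunique _ ((isSaturatedChain_map_iff hf).2 he) (isRising_map.2 her))
  · simpa only [edgeLabels_map] using
      hlex _ ((isSaturatedChain_map_iff hf).2 he) (hinj.ne hne)

theorem IsELLabeling.mem_of_isHigh [BoundedOrder P] [IsStronglyAtomic P] (hT : IsTreeLike P)
    {lab : P → P → Λ} (h : IsELLabeling lab) {R : List P}
    (hR : ∀ d, IsSaturatedChain ⊥ ⊤ d → IsRising lab d → d = R) (hy : IsHigh y) : y ∈ R := by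
  obtain ⟨c, hc, hrising, -⟩ := h ⊥ y bot_le
  rcases hc.cases with ⟨h0, -⟩ | ⟨a, c', ha, rfl, hac⟩
  · exact absurd h0.symm hy.ne_bot
  rcases hac.cases with ⟨rfl, -⟩ | ⟨b, c'', hab, hbc, hb⟩
  · obtain ⟨x, hx, hxa⟩ := hy
    exact absurd hxa (ha.2 (bot_lt_iff_ne_bot.2 hx))
  obtain ⟨-, rfl⟩ := List.cons.inj hbc
  have hlt : lab ⊥ a < lab a b := (List.isChain_cons_cons.1 hrising).1
  obtain ⟨r, hr, hrr, -⟩ := h a ⊤ le_top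
  -- The only atom of `[a, ⊤]` is `b`, so prepending `⊥` to `r` gives a rising chain.
  have hrise : IsRising lab (⊥ :: r) := by
    rcases hr.cases with ⟨-, rfl⟩ | ⟨b', r', hab', rfl, -⟩
    · exact .singleton _
    · obtain rfl := hT ha.lt.ne_bot hab hab'
      exact List.isChain_cons_cons.2 ⟨hlt, hrr⟩
  rw [← hR _ (hr.cons ha) hrise]
  exact List.mem_cons_of_mem _
    (hT.mem_of_isSaturatedChain ha.lt.ne_bot hr (hab.le.trans hb.le) le_top)

theorem IsELLabeling.isTwoPlusTwoFree [BoundedOrder P] [IsStronglyAtomic P] (hT : IsTreeLike P)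
    {lab : P → P → Λ} (h : IsELLabeling lab) : IsTwoPlusTwoFree P := by
  obtain ⟨R, hR, -, hunique, -⟩ := h (⊥ : P) ⊤ bot_le
  exact isTwoPlusTwoFree_of_isChain (hR.isChain.mono fun _ => h.mem_of_isHigh hT hunique)

theorem IsELShellable.isTwoPlusTwoFree [BoundedOrder P] [IsStronglyAtomic P]
    [IsStronglyCoatomic P] (hT : IsTreeLike P) {m : ℕ} [NeZero m]
    (h : IsELShellable (MCover P m)) : IsTwoPlusTwoFree P := by
  obtain ⟨-, -, Λ, _, lab, hlab⟩ := h
  exact (hlab.comp (isLowerSet_range_lastEmbedding m)).isTwoPlusTwoFree hT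

end EL

/-! ### The `m`-cover poset of a `2+2`-free tree-like poset is left-modular -/

/-- An atom below every element that is neither `⊥` nor an atom. -/
def IsBaseAtom {P : Type*} [PartialOrder P] [OrderBot P] (a : P) : Prop :=
  IsAtom a ∧ ∀ ⦃y⦄, IsHigh y → a ≤ y

theorem exists_isBaseAtom {P : Type*} [PartialOrder P] [BoundedOrder P] [Finite P] [Nontrivial P]
    (h : IsChain (· ≤ ·) {y : P | IsHigh y}) : ∃ a : P, IsBaseAtom a := by
  by_cases hex : ∃ y : P, IsHigh y
  · obtain ⟨c, hc, hmin⟩ := (Set.toFinite {y : P | IsHigh y}).exists_minimal hex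
    obtain ⟨a, ha, hac⟩ := (IsAtomic.eq_bot_or_exists_atom_le c).resolve_left hc.ne_bot
    exact ⟨a, ha, fun y hy => hac.trans ((h.total hc hy).elim id (hmin hy))⟩
  · push Not at hex
    have htop : IsAtom (⊤ : P) := ⟨top_ne_bot, fun x hx => by_contra fun h0 => hex ⊤ ⟨x, h0, hx⟩⟩
    exact ⟨⊤, htop, fun y hy => absurd hy (hex y)⟩

theorem isLatticePoset_of_exists_isGLB {Q : Type*} [PartialOrder Q] [OrderTop Q] [Finite Q]
    (h : ∀ x y : Q, ∃ g, IsGLB {x, y} g) : IsLatticePoset Q := by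
  refine fun x y => ⟨?_, h x y⟩
  obtain ⟨j, hj, hmin⟩ := (Set.toFinite (upperBounds {x, y})).exists_minimal ⟨⊤, fun _ _ => le_top⟩
  refine ⟨j, hj, fun u hu => ?_⟩
  obtain ⟨g, hg⟩ := h j u
  have hgub : g ∈ upperBounds {x, y} := fun z hz => hg.2 <| by
    rintro _ (rfl | rfl)
    exacts [hj hz, hu hz]
  exact (hmin hgub (hg.1 (by simp))).trans (hg.1 (by simp))

section Hull

variable {P : Type*} [PartialOrder P] [BoundedOrder P] [Finite P] {m : ℕ} [NeZero m]

theorem MCover.apply_top_le (hT : IsTreeLike P) (z : MCover P m) {i : Fin m} {b : P}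
    (h0 : z.1 i ≠ ⊥) (h : z.1 i < b) : z.1 ⊤ ≤ b :=
  hT.le_of_wcovBy h0 (z.wcovBy le_top h0) h

theorem MCover.le_apply_of_not_apply_top_le (hT : IsTreeLike P) (z : MCover P m) {i : Fin m}
    {b : P} (h0 : z.1 i ≠ ⊥) (h : z.1 i ≤ b) (hb : ¬ z.1 ⊤ ≤ b) : b ≤ z.1 i :=
  (h.eq_or_lt.resolve_right fun hlt => hb (z.apply_top_le hT h0 hlt)).ge

/-- An upper bound in the `m`-cover poset which is as close to `s` as the covering condition
allows: an entry strictly between `⊥` and `s ⊤` is raised to a lower cover of `s ⊤`. -/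
theorem exists_mCover_hull (hT : IsTreeLike P) {s : Fin m → P} (hs : Monotone s) :
    ∃ J : MCover P m, s ≤ J.1 ∧ ∀ i, J.1 i = s i ∨ s i ≠ ⊥ ∧ s i < J.1 i ∧ J.1 i < s ⊤ := by
  have hex : ∀ i, ∃ c, s i = ⊥ ∧ c = ⊥ ∨
      s i ≠ ⊥ ∧ s i ≤ c ∧ c ⩿ s ⊤ ∧ (c = s ⊤ → s i = s ⊤) := by
    intro i
    obtain h0 | h0 := eq_or_ne (s i) ⊥
    · exact ⟨⊥, Or.inl ⟨h0, rfl⟩⟩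
    rcases (hs (le_top (a := i))).eq_or_lt with htop | hlt
    · exact ⟨s i, Or.inr ⟨h0, le_rfl, htop ▸ WCovBy.rfl, id⟩⟩
    · obtain ⟨c, hc, hcov⟩ := exists_le_covBy_of_lt hlt
      exact ⟨c, Or.inr ⟨h0, hc, hcov.wcovBy, fun h => absurd h hcov.lt.ne⟩⟩
  choose c hc using hex
  refine ⟨.mk c fun i j hij => ?_, fun i => ?_, fun i => ?_⟩
  · rcases hc i with ⟨-, hbot⟩ | ⟨hi, hsi, hit, htop⟩
    · exact Or.inl hbot
    rcases hc j with ⟨hj, -⟩ | ⟨-, hsj, hjt, -⟩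
    · exact absurd (le_bot_iff.1 ((hs hij).trans_eq hj)) hi
    right
    rcases hT.total hi hsi ((hs hij).trans hsj) with hle | hle
    · exact hit.of_le_of_le' hjt.le hle
    · rcases hjt.eq_or_eq hle hit.le with heq | heq
      · exact heq ▸ WCovBy.rfl
      · have hst : s ⊤ ≤ c j := (htop heq).ge.trans ((hs hij).trans hsj)
        exact le_antisymm hle (hit.le.trans hst) ▸ WCovBy.rfl
  · exact (hc i).elim (fun h => h.1.trans_le bot_le) fun h => h.2.1
  · rcases hc i with ⟨h0, hbot⟩ | ⟨h0, hle, hcov, htop⟩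
    · exact Or.inl (hbot.trans h0.symm)
    · refine hle.eq_or_lt.imp Eq.symm fun hlt => ⟨h0, hlt, hcov.le.lt_of_ne fun heq => ?_⟩
      exact hlt.ne ((htop heq).trans heq.symm)

end Hull

/-- The tuples of the maximal chain that climbs a maximal chain of `P` through `a` by raising one
entry at a time, starting with the last: the tuples `(⊥, …, ⊥, a, …, a)`, followed by tuples with
all entries above `a`. -/
def IsSpineTuple {P : Type*} [PartialOrder P] [BoundedOrder P] {m : ℕ} [NeZero m] (a : P)
    (x : MCover P m) : Prop :=
  ∀ i, x.1 i = ⊥ ∧ x.1 ⊤ ≤ a ∨ a ≤ x.1 i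

section LeftModularMCover

variable {P : Type*} [Lattice P] [BoundedOrder P] [Finite P] {a : P} {m : ℕ}

theorem mem_mCover_inf (hT : IsTreeLike P) (x y : MCover P m) (i j : Fin m) (hij : i ≤ j) :
    x.1 i ⊓ y.1 i = ⊥ ∨ x.1 i ⊓ y.1 i ⩿ x.1 j ⊓ y.1 j := by
  refine or_iff_not_imp_left.2 fun h0 => ?_
  have hle : x.1 i ⊓ y.1 i ≤ x.1 j ⊓ y.1 j := inf_le_inf (x.monotone hij) (y.monotone hij)
  rcases hT.total h0 inf_le_left inf_le_right with h | h
  · rw [inf_eq_left.2 h] at h0 hle ⊢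
    exact (x.wcovBy hij h0).of_le_of_le' inf_le_left hle
  · rw [inf_eq_right.2 h] at h0 hle ⊢
    exact (y.wcovBy hij h0).of_le_of_le' inf_le_right hle

theorem IsTreeLike.isLatticePoset_mCover (hT : IsTreeLike P) (m : ℕ) :
    IsLatticePoset (MCover P m) := by
  refine isLatticePoset_of_exists_isGLB fun x y => ⟨.mk _ (mem_mCover_inf hT x y), ?_, ?_⟩
  · rintro _ (rfl | rfl) i
    exacts [inf_le_left, inf_le_right]
  · exact fun z hz i => le_inf (hz (by simp : x ∈ _) i) (hz (by simp : y ∈ _) i)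

theorem IsBaseAtom.sup_inf_le (ha : IsBaseAtom a) (hT : IsTreeLike P) {d u v : P}
    (hd : d = ⊥ ∨ a ≤ d) (huv : u ≤ v) : (u ⊔ d) ⊓ v ≤ u ⊔ (d ⊓ v) := by
  rcases hd with rfl | hd
  · simp
  obtain rfl | hu := eq_or_ne u ⊥
  · simp
  rcases huv.eq_or_lt with rfl | hlt
  · exact inf_le_right.trans le_sup_left
  rcases hT.total ha.1.1 hd (ha.2 ⟨u, hu, hlt⟩) with h | h
  · rw [inf_eq_left.2 h]
    exact inf_le_left
  · rw [inf_eq_right.2 h]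
    exact inf_le_right.trans le_sup_right

variable [NeZero m]

theorem IsSpineTuple.inf_le_of_sup_lt {x y y' w : MCover P m} (hx : IsSpineTuple a x)
    (ha : IsBaseAtom a) (hT : IsTreeLike P) (hyy' : y ≤ y') (hyw : y ≤ w) {i : Fin m} {b : P}
    (hxw : x.1 i ⊓ y'.1 i ≤ w.1 i) (h0 : y.1 i ⊔ x.1 i ≠ ⊥) (hb : y.1 i ⊔ x.1 i < b)
    (htop : b < y.1 ⊤ ⊔ x.1 ⊤) : b ⊓ y'.1 i ≤ w.1 i := by
  have hnot : ¬ (y.1 ⊤ ≤ b ∧ x.1 ⊤ ≤ b) := fun h => htop.not_ge (sup_le h.1 h.2)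
  have hax : a ≤ x.1 i := by
    refine (hx i).resolve_left fun ⟨hxi, hxa⟩ => hnot ⟨?_, hxa.trans (ha.2 ⟨_, h0, hb⟩)⟩
    rw [hxi, sup_bot_eq] at h0 hb
    exact y.apply_top_le hT h0 hb
  have hxi : x.1 i ≠ ⊥ := (ha.1.bot_lt.trans_le hax).ne'
  have hxb : x.1 i < b := le_sup_right.trans_lt hb
  have hyb : ¬ y.1 ⊤ ≤ b := fun h => hnot ⟨h, x.apply_top_le hT hxi hxb⟩
  obtain hmeet | hmeet := eq_or_ne (b ⊓ y'.1 i) ⊥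
  · exact hmeet.trans_le bot_le
  have hby' : b ≤ y'.1 i := (hT.total hmeet inf_le_left inf_le_right).elim id fun h =>
    y'.le_apply_of_not_apply_top_le hT (ne_bot_of_le_ne_bot hmeet inf_le_right) h
      fun h' => hyb ((hyy' ⊤).trans h')
  have hxw' : x.1 i ≤ w.1 i := (le_inf le_rfl (hxb.le.trans hby')).trans hxw
  have hbw : b ≤ w.1 i := (hT.total hxi hxb.le hxw').elim id fun h =>
    w.le_apply_of_not_apply_top_le hT (ne_bot_of_le_ne_bot hxi hxw') h
      fun h' => hyb ((hyw ⊤).trans h')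
  exact inf_le_left.trans hbw

theorem IsSpineTuple.isLeftModularElem (ha : IsBaseAtom a) (hT : IsTreeLike P)
    (h : IsLatticePoset (MCover P m)) {x : MCover P m} (hx : IsSpineTuple a x) :
    letI := h.toLattice
    IsLeftModularElem x := by
  let := h.toLattice
  intro y y' hy
  refine le_antisymm (fun i => ?_)
    (sup_le (le_inf le_sup_left hy.le) (inf_le_inf_right _ le_sup_right))
  obtain ⟨J, hsJ, hJ⟩ := exists_mCover_hull hT (y.monotone.sup x.monotone)
  have hle : (y ⊔ x) ⊓ y' ≤ J :=
    inf_le_left.trans (sup_le (fun i => le_sup_left.trans (hsJ i))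
      fun i => le_sup_right.trans (hsJ i))
  have hle' : (y ⊔ x) ⊓ y' ≤ y' := inf_le_right
  have hyw : y ≤ y ⊔ (x ⊓ y') := le_sup_left
  have hxw : ∀ i, x.1 i ⊓ y'.1 i ≤ (y ⊔ (x ⊓ y')).1 i := by
    have hmeet : .mk _ (mem_mCover_inf hT x y') ≤ x ⊓ y' :=
      le_inf (fun i => inf_le_left) (fun i => inf_le_right)
    exact hmeet.trans le_sup_right
  refine (le_inf (hle i) (hle' i)).trans ?_
  rcases hJ i with heq | ⟨h0, hlt, htop⟩
  · rw [heq]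
    exact (ha.sup_inf_le hT ((hx i).imp_left And.left) (hy.le i)).trans (sup_le (hyw i) (hxw i))
  · exact hx.inf_le_of_sup_lt ha hT hy.le hyw (hxw i) h0 hlt htop

end LeftModularMCover

section Spine

variable {P : Type*} [PartialOrder P] [BoundedOrder P] [Finite P] {a q : P} {m : ℕ}

theorem exists_covBy_eq_update {x : MCover P m} {i : Fin m} (hq : x.1 i ⋖ q)
    (hlow : ∀ j ≤ i, x.1 j = x.1 i) (hupp : ∀ j, i < j → x.1 j = q) :
    ∃ y : MCover P m, x ⋖ y ∧ y.1 = Function.update x.1 i q := by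
  have hlt : ∀ j < i, Function.update x.1 i q j = x.1 i := fun j hj =>
    (Function.update_of_ne hj.ne q x.1).trans (hlow j hj.le)
  have hge : ∀ j, i ≤ j → Function.update x.1 i q j = q := fun j hj => by
    rcases hj.eq_or_lt with rfl | hj
    · exact Function.update_self ..
    · exact (Function.update_of_ne hj.ne' q x.1).trans (hupp j hj)
  have hmem : ∀ j k, j ≤ k → Function.update x.1 i q j = ⊥ ∨
      Function.update x.1 i q j ⩿ Function.update x.1 i q k := by
    intro j k hjk
    right
    rcases lt_or_ge j i with hj | hj
    · rcases lt_or_ge k i with hk | hk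
      · rw [hlt j hj, hlt k hk]
        exact WCovBy.rfl
      · rw [hlt j hj, hge k hk]
        exact hq.wcovBy
    · rw [hge j hj, hge k (hj.trans hjk)]
      exact WCovBy.rfl
  have hcov : x.1 ⋖ Function.update x.1 i q :=
    Pi.covBy_iff.2 ⟨i, by rwa [Function.update_self],
      fun j hj => (Function.update_of_ne hj q x.1).symm⟩
  exact ⟨.mk _ hmem, CovBy.of_image (OrderEmbedding.subtype _) hcov, rfl⟩

variable [NeZero m]

theorem IsSpineTuple.exists_covBy_entry (ha : IsAtom a) {x : MCover P m} (hx : IsSpineTuple a x)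
    (htop : x ≠ ⊤) : ∃ i q, x.1 i ⋖ q ∧ a ≤ q ∧ (x.1 i = ⊥ → q ≤ a) ∧
      (∀ j ≤ i, x.1 j = x.1 i) ∧ ∀ j, i < j → x.1 j = q := by
  by_cases hconst : ∀ i, x.1 i = x.1 ⊤
  · refine ⟨⊤, ?_⟩
    suffices ∃ q, x.1 ⊤ ⋖ q ∧ a ≤ q ∧ (x.1 ⊤ = ⊥ → q ≤ a) from
      this.imp fun q hq => ⟨hq.1, hq.2.1, hq.2.2, fun j _ => hconst j,
        fun j hj => absurd hj (not_lt_of_ge le_top)⟩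
    rcases hx ⊤ with ⟨h0, -⟩ | hax
    · exact ⟨a, h0 ▸ ha.bot_covBy, le_rfl, fun _ => le_rfl⟩
    · have hlt : x.1 ⊤ < ⊤ := lt_top_iff_ne_top.2 fun h =>
        htop (Subtype.ext (funext fun i => (hconst i).trans h))
      obtain ⟨q, hq, -⟩ := exists_covBy_le_of_lt hlt
      exact ⟨q, hq, hax.trans hq.le, fun h => absurd (le_bot_iff.1 (h ▸ hax)) ha.1⟩
  · push Not at hconst
    obtain ⟨i, hi, hmax⟩ := (Set.toFinite {i | x.1 i ≠ x.1 ⊤}).exists_maximal hconst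
    have hlt : x.1 i < x.1 ⊤ := (x.monotone le_top).lt_of_ne hi
    have hbot : ∀ j, x.1 j = ⊥ → x.1 ⊤ ≤ a := fun j hj =>
      (hx j).elim And.right fun h => absurd (le_bot_iff.1 (h.trans_eq hj)) ha.1
    have hatop : a ≤ x.1 ⊤ := (hx ⊤).resolve_left fun h => not_lt_bot (hlt.trans_eq h.1)
    have hcov : x.1 i ⋖ x.1 ⊤ := by
      by_cases h0 : x.1 i = ⊥
      · rw [h0, (hbot i h0).antisymm hatop]
        exact ha.bot_covBy
      · exact (x.wcovBy le_top h0).covBy_of_lt hlt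
    refine ⟨i, x.1 ⊤, hcov, hatop, hbot i, fun j hj => ?_,
      fun j hj => by_contra fun hne => hj.not_ge (hmax hne hj.le)⟩
    by_cases h0 : x.1 j = ⊥
    · exact h0.trans (ha.2 _ (hlt.trans_le (hbot j h0))).symm
    · exact (((x.wcovBy le_top h0).eq_or_eq (x.monotone hj) hlt.le).resolve_right hlt.ne).symm

theorem IsSpineTuple.exists_covBy (ha : IsAtom a) {x : MCover P m} (hx : IsSpineTuple a x)
    (htop : x ≠ ⊤) : ∃ y, IsSpineTuple a y ∧ x ⋖ y := by
  obtain ⟨i, q, hq, haq, hqa, hlow, hupp⟩ := hx.exists_covBy_entry ha htop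
  obtain ⟨y, hxy, hy⟩ := exists_covBy_eq_update hq hlow hupp
  have hytop : y.1 ⊤ = q := by
    rw [hy]
    rcases (le_top (a := i)).eq_or_lt with rfl | hi
    · exact Function.update_self ..
    · rw [Function.update_of_ne hi.ne', hupp ⊤ hi]
  refine ⟨y, fun k => ?_, hxy⟩
  rw [hytop, hy]
  rcases lt_trichotomy k i with hk | rfl | hk
  · rw [Function.update_of_ne hk.ne]
    exact (hx k).imp_left fun h => ⟨h.1, hqa ((hlow k hk.le).symm.trans h.1)⟩
  · rw [Function.update_self]
    exact Or.inr haq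
  · rw [Function.update_of_ne hk.ne', hupp k hk]
    exact Or.inr haq

theorem exists_isSaturatedChain_isSpineTuple (ha : IsAtom a) :
    ∃ c : List (MCover P m), IsSaturatedChain ⊥ ⊤ c ∧ ∀ x ∈ c, IsSpineTuple a x :=
  exists_isSaturatedChain_top (S := {x | IsSpineTuple a x})
    (fun _ hx htop => hx.exists_covBy ha htop) fun _ => Or.inl ⟨rfl, bot_le⟩

end Spine

theorem IsLatticePoset.isLeftModularLattice_of_subsingleton {Q : Type*} [PartialOrder Q]
    [Nonempty Q] [Subsingleton Q] (h : IsLatticePoset Q) : IsLeftModularLattice Q := by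
  obtain ⟨x⟩ := ‹Nonempty Q›
  exact ⟨h, x, x, [x], fun y => (Subsingleton.elim x y).le, fun y => (Subsingleton.elim y x).le,
    .singleton x, fun _ _ y y' hy => absurd (Subsingleton.elim y y') hy.ne⟩

theorem IsTreeLike.isLeftModularLattice_mCover {P : Type*} [Lattice P] [BoundedOrder P] [Finite P]
    (hT : IsTreeLike P) (hfree : IsTwoPlusTwoFree P) (m : ℕ) [NeZero m] :
    IsLeftModularLattice (MCover P m) := by
  have hL := hT.isLatticePoset_mCover m
  rcases subsingleton_or_nontrivial P with _ | _
  · exact hL.isLeftModularLattice_of_subsingleton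
  · obtain ⟨a, ha⟩ := exists_isBaseAtom (hT.isTwoPlusTwoFree_iff.1 hfree)
    obtain ⟨c, hc, hspine⟩ := exists_isSaturatedChain_isSpineTuple (m := m) ha.1
    exact ⟨hL, ⊥, ⊤, c, isBot_bot, isTop_top, hc,
      fun x hx => (hspine x hx).isLeftModularElem ha hT hL⟩

/-! ### Path posets are `2+2`-free -/

section PathOrder

variable {w : NEPath} {i j : Fin w.length}

theorem NEPath.get_eq_east_iff : w.get i = .east ↔ w.get i ≠ .north := by
  cases w.get i <;> simp

theorem NEPath.StepCov.lt_of_north (h : w.StepCov i j) (hi : w.get i = .north) : i < j := by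
  cases h with
  | north hij => exact hij
  | east hi' => cases hi.symm.trans hi'

theorem NEPath.stepLE_of_north (hi : w.get i = .north) (hj : w.get j = .north) (hij : i ≤ j) :
    w.StepLE i j := by
  induction j using WellFoundedLT.induction with
  | ind j ih =>
    rcases hij.eq_or_lt with rfl | hlt
    · exact .refl
    obtain ⟨s, hs, hmax⟩ := (Set.toFinite {s | s < j ∧ w.get s = .north}).exists_maximal
      ⟨i, hlt, hi⟩
    have his : i ≤ s := (le_total i s).elim id (hmax ⟨hlt, hi⟩)
    exact (ih s hs.1 hs.2 his).tail
      (.north hs.1 hs.2 hj fun t hst htj ht => hst.not_ge (hmax ⟨htj, ht⟩ hst.le))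

theorem NEPath.blockStart_eq_succ_iff (w : NEPath) {n b : ℕ} : w.blockStart n = b + 1 ↔
    b < n ∧ w[b]? ≠ some .east ∧ ∀ s, b < s → s < n → w[s]? = some .east := by
  induction n with
  | zero => simp [NEPath.blockStart]
  | succ n ih =>
    rw [NEPath.blockStart]
    split
    case h_1 hn =>
      rw [ih]
      constructor
      · rintro ⟨hb, hwb, hs⟩
        refine ⟨hb.trans n.lt_succ_self, hwb, fun s hbs hsn => ?_⟩
        exact (Nat.lt_succ_iff_lt_or_eq.1 hsn).elim (hs s hbs) fun h => h ▸ hn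
      · rintro ⟨hb, hwb, hs⟩
        have hbn : b < n := (Nat.lt_succ_iff_lt_or_eq.1 hb).resolve_right fun h => hwb (h ▸ hn)
        exact ⟨hbn, hwb, fun s hbs hsn => hs s hbs (hsn.trans n.lt_succ_self)⟩
    case h_2 hn =>
      constructor
      · intro h
        obtain rfl : n = b := by omega
        exact ⟨n.lt_succ_self, hn, fun s hbs hsn => by omega⟩
      · rintro ⟨hb, -, hs⟩
        by_contra hne
        exact hn (hs n (by omega) n.lt_succ_self)

theorem NEPath.stepCov_iff_isGreatest (hi : w.get i = .east) :
    w.StepCov i j ↔ IsGreatest {s | s ≤ i ∧ w.get s = .north} j := by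
  have get? : ∀ (s : Fin w.length) (c : NEStep), w[(s : ℕ)]? = some c ↔ w.get s = c :=
    fun s c => by simp
  constructor
  · rintro (⟨-, hi', -, -⟩ | ⟨-, hj, hstart⟩)
    · cases hi.symm.trans hi'
    · obtain ⟨hji, -, hblock⟩ := w.blockStart_eq_succ_iff.1 hstart
      refine ⟨⟨hji.le, hj⟩, fun s ⟨hsi, hs⟩ => le_of_not_gt fun hjs => ?_⟩
      have hne : s ≠ i := by
        rintro rfl
        cases hi.symm.trans hs
      cases ((get? s _).1 (hblock s hjs (hsi.lt_of_ne hne))).symm.trans hs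
  · rintro ⟨⟨hji, hj⟩, hmax⟩
    have hne : j ≠ i := by
      rintro rfl
      cases hi.symm.trans hj
    refine .east hi hj (w.blockStart_eq_succ_iff.2 ⟨hji.lt_of_ne hne, ?_, fun s hjs hsi => ?_⟩)
    · rw [Ne, get?, hj]
      nofun
    · refine (get? ⟨s, hsi.trans i.2⟩ _).2 (NEPath.get_eq_east_iff.2 fun hs => ?_)
      exact (hmax ⟨hsi.le, hs⟩).not_gt hjs

theorem NEPath.stepLE_iff : w.StepLE i j ↔ i = j ∨
    w.get j = .north ∧ ∃ s ≤ j, IsGreatest {s | s ≤ i ∧ w.get s = .north} s := by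
  constructor
  · intro h
    refine or_iff_not_imp_left.2 fun hne => ⟨h.north.resolve_left hne, ?_⟩
    induction h with
    | refl => exact absurd rfl hne
    | @tail k j hik hkj ih =>
      by_cases hk : w.get k = .north
      · have hkj' : k ≤ j := (hkj.lt_of_north hk).le
        obtain rfl | hne' := eq_or_ne i k
        · exact ⟨i, hkj', ⟨le_rfl, hk⟩, fun s hs => hs.1⟩
        · exact (ih hne').imp fun s hs => ⟨hs.1.trans hkj', hs.2⟩
      · obtain rfl : i = k := (NEPath.StepLE.north hik).resolve_right hk
        exact ⟨j, le_rfl, (NEPath.stepCov_iff_isGreatest (NEPath.get_eq_east_iff.2 hk)).1 hkj⟩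
  · rintro (rfl | ⟨hj, s, hsj, hs⟩)
    · exact .refl
    have hsj' : w.StepLE s j := NEPath.stepLE_of_north hs.1.2 hj hsj
    by_cases hi : w.get i = .north
    · rwa [(hs.2 ⟨le_rfl, hi⟩).antisymm hs.1.1]
    · exact .head ((NEPath.stepCov_iff_isGreatest (NEPath.get_eq_east_iff.2 hi)).2 hs) hsj'

end PathOrder

namespace PathPoset

variable {P : Type*} [PartialOrder P] [BoundedOrder P] {w : NEPath} {p q : P} {i j : Fin w.length}

theorem base_le_base : (base p : PathPoset P w) ≤ base q ↔ p ≤ q := Iff.rfl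

theorem step_le_step : (step i : PathPoset P w) ≤ step j ↔ w.StepLE i j := Iff.rfl

theorem base_le_step : (base p : PathPoset P w) ≤ step j ↔ p = ⊥ ∨ w.get j = .north := by
  change p = ⊥ ∧ w.get j = .east ∨ w.get j = .north ↔ _
  rw [NEPath.get_eq_east_iff]
  tauto

theorem not_step_le_base : ¬ (step i : PathPoset P w) ≤ base p := id

instance : OrderBot (PathPoset P w) where
  bot := base ⊥
  bot_le
    | base _ => base_le_base.2 bot_le
    | step _ => base_le_step.2 (Or.inl rfl)

theorem isHigh_of_isHigh_base (h : IsHigh (base q : PathPoset P w)) : IsHigh q := by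
  obtain ⟨p | i, hp, hlt⟩ := h
  · have hne : p ≠ q := fun h => hlt.ne (congrArg base h)
    exact ⟨p, fun h => hp (congrArg base h), (base_le_base.1 hlt.le).lt_of_ne hne⟩
  · exact absurd hlt.le not_step_le_base

theorem get_eq_north_of_isHigh_step (h : IsHigh (step j : PathPoset P w)) :
    w.get j = .north := by
  obtain ⟨p | i, hp, hlt⟩ := h
  · exact (base_le_step.1 hlt.le).resolve_left fun h => hp (congrArg base h)
  · exact (step_le_step.1 hlt.le).north.resolve_left fun h => hlt.ne (congrArg step h)

theorem isChain_isHigh (h : IsChain (· ≤ ·) {y : P | IsHigh y}) :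
    IsChain (· ≤ ·) {y : PathPoset P w | IsHigh y} := by
  rintro (p | i) hx (q | j) hy -
  · exact h.total (isHigh_of_isHigh_base hx) (isHigh_of_isHigh_base hy)
  · exact Or.inl (base_le_step.2 (Or.inr (get_eq_north_of_isHigh_step hy)))
  · exact Or.inr (base_le_step.2 (Or.inr (get_eq_north_of_isHigh_step hx)))
  · have hi := get_eq_north_of_isHigh_step hx
    have hj := get_eq_north_of_isHigh_step hy
    exact (le_total i j).imp (NEPath.stepLE_of_north hi hj) (NEPath.stepLE_of_north hj hi)

end PathPoset

theorem isChain_isHigh_chainAntichain (k l : ℕ) :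
    IsChain (· ≤ ·) {y : ChainAntichain k l | IsHigh y} := by
  have high_cases : ∀ y : ChainAntichain k l, IsHigh y → y = ⊤ ∨
      ∃ i : Fin k, y = ((Sum.inl i : Fin k ⊕ AntichainPoset l) :) := by
    rintro y ⟨x, hx, hxy⟩
    obtain ⟨x, rfl⟩ := WithBot.ne_bot_iff_exists.1 hx
    obtain ⟨y, rfl⟩ := WithBot.ne_bot_iff_exists.1 hxy.ne_bot
    rw [WithBot.coe_lt_coe] at hxy
    obtain ⟨x, rfl⟩ := WithTop.ne_top_iff_exists.1 hxy.ne_top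
    induction y using WithTop.recTopCoe with
    | top => exact Or.inl rfl
    | coe y =>
      rw [WithTop.coe_lt_coe] at hxy
      rcases y with i | y
      · exact Or.inr ⟨i, rfl⟩
      · rcases x with x | x
        · exact absurd hxy Sum.not_inl_lt_inr
        · have hxy : x < y := Sum.inr_lt_inr_iff.1 hxy
          exact absurd hxy.le hxy.ne
  intro y hy y' hy' _
  rcases high_cases y hy with rfl | ⟨i, rfl⟩
  · exact Or.inr le_top
  rcases high_cases y' hy' with rfl | ⟨i', rfl⟩
  · exact Or.inl le_top
  · exact (le_total i i').imp (by simp) (by simp)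

theorem isTwoPlusTwoFree_pathPoset (k l : ℕ) (w : NEPath) :
    IsTwoPlusTwoFree (PathPoset (ChainAntichain k l) w) :=
  isTwoPlusTwoFree_of_isChain (PathPoset.isChain_isHigh (isChain_isHigh_chainAntichain k l))

theorem IsTwoPlusTwoFree.of_orderIso {P Q : Type*} [PartialOrder P] [PartialOrder Q] (e : P ≃o Q)
    (h : IsTwoPlusTwoFree Q) : IsTwoPlusTwoFree P := by
  rintro ⟨x, y, x', y', hxy, hxy', h1, h2⟩
  exact h ⟨e x, e y, e x', e y', e.lt_iff_lt.2 hxy, e.lt_iff_lt.2 hxy',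
    by simpa only [e.le_iff_le] using h1, by simpa only [e.le_iff_le] using h2⟩

/-! ### Recognizing path posets -/

section HighAbove

variable {P : Type*} [PartialOrder P] [OrderBot P] {x y h : P}

/-- The set of high elements above `x`. -/
def highAbove (x : P) : Set P :=
  {c | IsHigh c ∧ x ≤ c}

variable [Finite P]

theorem exists_isLeast_highAbove (hc : IsChain (· ≤ ·) {y : P | IsHigh y})
    (hne : (highAbove x).Nonempty) : ∃ h, IsLeast (highAbove x) h := by
  obtain ⟨h, hh, hmin⟩ := (Set.toFinite (highAbove x)).exists_minimal hne
  exact ⟨h, hh, fun c hxc => (hc.total hh.1 hxc.1).elim id (hmin hxc)⟩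

theorem le_iff_exists_isLeast_highAbove (hc : IsChain (· ≤ ·) {y : P | IsHigh y}) (hx : x ≠ ⊥) :
    x ≤ y ↔ x = y ∨ IsHigh y ∧ ∃ h ≤ y, IsLeast (highAbove x) h := by
  constructor
  · intro hxy
    refine hxy.eq_or_lt.imp_right fun hlt => ?_
    have hy : IsHigh y := ⟨x, hx, hlt⟩
    obtain ⟨h, hh⟩ := exists_isLeast_highAbove hc ⟨y, hy, hxy⟩
    exact ⟨hy, h, hh.2 ⟨hy, hxy⟩, hh⟩
  · rintro (rfl | ⟨-, h, hhy, hh⟩)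
    exacts [le_rfl, hh.1.2.trans hhy]

open Classical in
/-- The key by which the letters of a path are sorted: a high element comes after the high elements
below it, and any other element right after the high elements below everything in
`highAbove x`. -/
noncomputable def pathKey (x : P) : ℕ :=
  2 * {c : P | IsHigh c ∧ ¬ x ≤ c}.ncard + if IsHigh x then 0 else 1

theorem pathKey_le_pathKey_iff (hc : IsChain (· ≤ ·) {y : P | IsHigh y}) (hh : IsHigh h) :
    pathKey h ≤ pathKey x ↔ h ∈ lowerBounds (highAbove x) := by
  constructor
  · intro hle c ⟨hch, hxc⟩
    by_contra hhc
    have hlt : c ≤ h := (hc.total hch hh).resolve_right hhc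
    have hcard : {c : P | IsHigh c ∧ ¬ x ≤ c}.ncard < {c : P | IsHigh c ∧ ¬ h ≤ c}.ncard :=
      Set.ncard_lt_ncard ⟨fun d hd => ⟨hd.1, fun hhd => hd.2 (hxc.trans (hlt.trans hhd))⟩,
        fun hsub => (hsub ⟨hch, hhc⟩).2 hxc⟩
    unfold pathKey at hle
    rw [if_pos hh] at hle
    split_ifs at hle <;> omega
  · intro hhx
    have hcard : {c : P | IsHigh c ∧ ¬ h ≤ c}.ncard ≤ {c : P | IsHigh c ∧ ¬ x ≤ c}.ncard :=
      Set.ncard_le_ncard fun d hd => ⟨hd.1, fun hxd => hd.2 (hhx ⟨hd.1, hxd⟩)⟩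
    unfold pathKey
    rw [if_pos hh]
    omega

theorem eq_of_pathKey_eq (hc : IsChain (· ≤ ·) {y : P | IsHigh y}) (hh : IsHigh h)
    (heq : pathKey x = pathKey h) : x = h := by
  have hx : IsHigh x := by
    by_contra hx
    unfold pathKey at heq
    rw [if_pos hh, if_neg hx] at heq
    omega
  exact ((pathKey_le_pathKey_iff hc hx).1 heq.le ⟨hh, le_rfl⟩).antisymm
    ((pathKey_le_pathKey_iff hc hh).1 heq.ge ⟨hx, le_rfl⟩)

end HighAbove

theorem exists_injective_monotone_comp {α β : Type*} [LinearOrder β] (f : α → β) {S : Set α}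
    (hS : S.Finite) : ∃ (n : ℕ) (ψ : Fin n → α),
      Function.Injective ψ ∧ Set.range ψ = S ∧ Monotone (f ∘ ψ) := by
  have := hS.to_subtype
  obtain ⟨n, ⟨e⟩⟩ := Finite.exists_equiv_fin S
  let σ := Tuple.sort fun i => f (e.symm i)
  refine ⟨n, fun i => e.symm (σ i), ?_, ?_, Tuple.monotone_sort fun i => f (e.symm i)⟩
  · exact Subtype.val_injective.comp (e.symm.injective.comp σ.injective)
  · exact ((σ.trans e.symm).surjective.range_comp Subtype.val).trans Subtype.range_val

/-- The elements of `P` other than `⊥` and `a`, listed as the letters of the path `w`: high elements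
are north-steps, and the north-steps up to `φ i` are the high elements below all of
`highAbove (φ i)`. -/
structure IsPathEnumeration {P : Type*} [PartialOrder P] [OrderBot P] (a : P) (w : NEPath)
    (φ : Fin w.length → P) : Prop where
  injective : Function.Injective φ
  range_eq : Set.range φ = {x | x ≠ ⊥ ∧ x ≠ a}
  get_eq_north_iff (i) : w.get i = .north ↔ IsHigh (φ i)
  le_iff {s} (hs : IsHigh (φ s)) (i) : s ≤ i ↔ φ s ∈ lowerBounds (highAbove (φ i))

theorem exists_isPathEnumeration {P : Type*} [PartialOrder P] [OrderBot P] [Finite P] (a : P)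
    (hc : IsChain (· ≤ ·) {y : P | IsHigh y}) :
    ∃ (w : NEPath) (φ : Fin w.length → P), IsPathEnumeration a w φ := by
  classical
  obtain ⟨n, ψ, hinj, hrange, hmono⟩ :=
    exists_injective_monotone_comp pathKey (Set.toFinite {x : P | x ≠ ⊥ ∧ x ≠ a})
  obtain ⟨w, rfl, hw⟩ : ∃ (w : NEPath) (h : w.length = n),
      ∀ i, w.get i = if IsHigh (ψ (i.cast h)) then .north else .east :=
    ⟨List.ofFn fun i => if IsHigh (ψ i) then .north else .east, List.length_ofFn,
      List.get_ofFn _⟩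
  refine ⟨w, ψ, hinj, hrange, fun i => ?_, fun {s} hs i => ?_⟩
  · rw [hw]
    split_ifs <;> simp_all
  rw [← pathKey_le_pathKey_iff hc hs]
  refine ⟨fun hsi => hmono hsi, fun hle => le_of_not_gt fun his => his.ne ?_⟩
  exact hinj (eq_of_pathKey_eq hc hs ((hmono his.le).antisymm hle))

section Recognition

variable {P : Type*} [PartialOrder P] [BoundedOrder P] {a x : P} {w : NEPath}
  {φ : Fin w.length → P}

theorem IsBaseAtom.isHigh_iff (ha : IsBaseAtom a) (hne : x ≠ a) : IsHigh x ↔ a ≤ x :=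
  ⟨@ha.2 x, fun h => ⟨a, ha.1.1, h.lt_of_ne' hne⟩⟩

namespace IsPathEnumeration

theorem apply_ne_bot (h : IsPathEnumeration a w φ) (i : Fin w.length) : φ i ≠ ⊥ :=
  (h.range_eq.le ⟨i, rfl⟩).1

theorem apply_ne (h : IsPathEnumeration a w φ) (i : Fin w.length) : φ i ≠ a :=
  (h.range_eq.le ⟨i, rfl⟩).2

theorem exists_eq_of_isHigh (h : IsPathEnumeration a w φ) (ha : IsAtom a) (hx : IsHigh x) :
    ∃ i, φ i = x := by
  refine h.range_eq.ge ⟨hx.ne_bot, ?_⟩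
  rintro rfl
  obtain ⟨y, hy, hlt⟩ := hx
  exact hy (ha.2 y hlt)

theorem apply_le_apply_iff (h : IsPathEnumeration a w φ) {s t : Fin w.length}
    (hs : IsHigh (φ s)) (ht : IsHigh (φ t)) : φ s ≤ φ t ↔ s ≤ t := by
  rw [h.le_iff hs t]
  exact ⟨fun hst _ hc => hst.trans hc.2, fun hst => hst ⟨ht, le_rfl⟩⟩

theorem isGreatest_iff_isLeast_highAbove [Finite P] (h : IsPathEnumeration a w φ) (ha : IsAtom a)
    (hc : IsChain (· ≤ ·) {y : P | IsHigh y}) {i s : Fin w.length} :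
    IsGreatest {s | s ≤ i ∧ w.get s = .north} s ↔ IsLeast (highAbove (φ i)) (φ s) := by
  have least_to_greatest : ∀ {r}, IsLeast (highAbove (φ i)) (φ r) →
      IsGreatest {s | s ≤ i ∧ w.get s = .north} r := fun {r} hr =>
    ⟨⟨(h.le_iff hr.1.1 i).2 hr.2, (h.get_eq_north_iff r).2 hr.1.1⟩, fun t ht => by
      have hht := (h.get_eq_north_iff t).1 ht.2
      exact (h.apply_le_apply_iff hht hr.1.1).1 ((h.le_iff hht i).1 ht.1 hr.1)⟩
  refine ⟨fun hs => ?_, least_to_greatest⟩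
  have htop : IsHigh (⊤ : P) := ((h.get_eq_north_iff s).1 hs.1.2).mono le_top
  obtain ⟨c, hr⟩ := exists_isLeast_highAbove hc ⟨⊤, htop, le_top (a := φ i)⟩
  obtain ⟨r, rfl⟩ := h.exists_eq_of_isHigh ha hr.1.1
  rwa [hs.unique (least_to_greatest hr)]

theorem le_iff_stepLE [Finite P] (h : IsPathEnumeration a w φ) (ha : IsAtom a)
    (hc : IsChain (· ≤ ·) {y : P | IsHigh y}) {i j : Fin w.length} :
    φ i ≤ φ j ↔ w.StepLE i j := by
  rw [le_iff_exists_isLeast_highAbove hc (h.apply_ne_bot i), NEPath.stepLE_iff, h.injective.eq_iff,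
    h.get_eq_north_iff]
  refine or_congr_right (and_congr_right fun hj => ⟨?_, ?_⟩)
  · rintro ⟨c, hcj, hleast⟩
    obtain ⟨s, rfl⟩ := h.exists_eq_of_isHigh ha hleast.1.1
    exact ⟨s, (h.apply_le_apply_iff hleast.1.1 hj).1 hcj,
      (h.isGreatest_iff_isLeast_highAbove ha hc).2 hleast⟩
  · rintro ⟨s, hsj, hs⟩
    have hleast := (h.isGreatest_iff_isLeast_highAbove ha hc).1 hs
    exact ⟨φ s, (h.apply_le_apply_iff hleast.1.1 hj).2 hsj, hleast⟩

end IsPathEnumeration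

theorem eq_bot_or_eq_top_of_chainAntichain_zero (p : ChainAntichain 0 0) : p = ⊥ ∨ p = ⊤ := by
  induction p using WithBot.recBotCoe with
  | bot => exact Or.inl rfl
  | coe p =>
    induction p using WithTop.recTopCoe with
    | top => exact Or.inr rfl
    | coe p => exact p.elim Fin.elim0 fun i => i.idx.elim0

open Classical in
/-- The map from a path poset to the poset enumerated by `φ`; the base has only the elements `⊥` and
`⊤`, the latter of which goes to `a`. -/
noncomputable def ofPathPoset (a : P) (φ : Fin w.length → P) :
    PathPoset (ChainAntichain 0 0) w → P
  | .base p => if p = ⊥ then ⊥ else a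
  | .step j => φ j

theorem ofPathPoset_base_bot : ofPathPoset a φ (.base ⊥) = ⊥ := by
  simp [ofPathPoset]

theorem ofPathPoset_base_top : ofPathPoset a φ (.base ⊤) = a := by
  simp [ofPathPoset]

theorem ofPathPoset_step (i : Fin w.length) : ofPathPoset a φ (.step i) = φ i := rfl

theorem IsPathEnumeration.ofPathPoset_le_iff [Finite P] (h : IsPathEnumeration a w φ)
    (ha : IsBaseAtom a) (hc : IsChain (· ≤ ·) {y : P | IsHigh y}) :
    ∀ {x y}, ofPathPoset a φ x ≤ ofPathPoset a φ y ↔ x ≤ y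
  | .base p, .base q => by
    rw [PathPoset.base_le_base]
    rcases eq_bot_or_eq_top_of_chainAntichain_zero p with rfl | rfl <;>
      rcases eq_bot_or_eq_top_of_chainAntichain_zero q with rfl | rfl <;>
      simp [ofPathPoset_base_bot, ofPathPoset_base_top, ha.1.1]
  | .base p, .step j => by
    rw [PathPoset.base_le_step, ofPathPoset_step, h.get_eq_north_iff, ha.isHigh_iff (h.apply_ne j)]
    rcases eq_bot_or_eq_top_of_chainAntichain_zero p with rfl | rfl <;>
      simp [ofPathPoset_base_bot, ofPathPoset_base_top]
  | .step i, .base q => by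
    refine iff_of_false (fun hle => ?_) PathPoset.not_step_le_base
    have hqa : ofPathPoset a φ (.base q) ≤ a := by
      rcases eq_bot_or_eq_top_of_chainAntichain_zero q with rfl | rfl <;>
        simp [ofPathPoset_base_bot, ofPathPoset_base_top]
    exact (ha.1.le_iff.1 (hle.trans hqa)).elim (h.apply_ne_bot i) (h.apply_ne i)
  | .step _, .step _ => h.le_iff_stepLE ha.1 hc

theorem IsPathEnumeration.surjective_ofPathPoset (h : IsPathEnumeration a w φ) :
    Function.Surjective (ofPathPoset a φ) := by
  intro x
  by_cases h0 : x = ⊥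
  · exact ⟨.base ⊥, ofPathPoset_base_bot.trans h0.symm⟩
  by_cases h1 : x = a
  · exact ⟨.base ⊤, ofPathPoset_base_top.trans h1.symm⟩
  obtain ⟨i, hi⟩ := h.range_eq.ge ⟨h0, h1⟩
  exact ⟨.step i, hi⟩

theorem exists_orderIso_pathPoset [Finite P] [Nontrivial P]
    (hc : IsChain (· ≤ ·) {y : P | IsHigh y}) :
    ∃ w : NEPath, Nonempty (P ≃o PathPoset (ChainAntichain 0 0) w) := by
  obtain ⟨a, ha⟩ := exists_isBaseAtom hc
  obtain ⟨w, φ, h⟩ := exists_isPathEnumeration a hc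
  let f := OrderEmbedding.ofMapLEIff (ofPathPoset a φ) fun _ _ => h.ofPathPoset_le_iff ha hc
  exact ⟨w, ⟨(RelIso.ofSurjective f h.surjective_ofPathPoset).symm⟩⟩

end Recognition

theorem isTwoPlusTwoFree_iff_exists_orderIso_pathPoset {P : Type*} [PartialOrder P]
    [BoundedOrder P] [Finite P] (hT : IsTreeLike P) : IsTwoPlusTwoFree P ↔ Nat.card P = 1 ∨
      ∃ (k l : ℕ) (w : NEPath), Nonempty (P ≃o PathPoset (ChainAntichain k l) w) := by
  constructor
  · intro h
    rcases subsingleton_or_nontrivial P with hs | hs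
    · exact Or.inl (Nat.card_eq_one_iff_unique.2 ⟨hs, ⟨⊥⟩⟩)
    · exact Or.inr ⟨0, 0, exists_orderIso_pathPoset (hT.isTwoPlusTwoFree_iff.1 h)⟩
  · rintro (h | ⟨k, l, w, ⟨e⟩⟩)
    · have := (Nat.card_eq_one_iff_unique.1 h).1
      rintro ⟨x, y, -, -, hxy, -⟩
      exact hxy.ne (Subsingleton.elim x y)
    · exact (isTwoPlusTwoFree_pathPoset k l w).of_orderIso e

end CoverPoset

theorem theorem1p2_general (P : Type*) [PartialOrder P] [BoundedOrder P] [Finite P]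
    (hP : CoverPoset.IsLatticePoset (CoverPoset.MCover P 2)) (m : ℕ) (hm : 0 < m) :
    List.TFAE [
      (Nat.card P = 1 ∨ ∃ (k l : ℕ) (w : CoverPoset.NEPath),
        Nonempty (P ≃o CoverPoset.PathPoset (CoverPoset.ChainAntichain k l) w)),
      CoverPoset.IsTwoPlusTwoFree P,
      CoverPoset.IsLeftModularLattice (CoverPoset.MCover P m),
      CoverPoset.IsELShellable (CoverPoset.MCover P m)] := by
  open CoverPoset in
  have : NeZero m := ⟨hm.ne'⟩
  have hT : IsTreeLike P := isTreeLike_of_isLatticePoset_mCover_two hP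
  let := (hP.of_isLowerSet (isLowerSet_range_lastEmbedding 2)).toLattice
  tfae_have 1 ↔ 2 := (isTwoPlusTwoFree_iff_exists_orderIso_pathPoset hT).symm
  tfae_have 2 → 3 := fun h => hT.isLeftModularLattice_mCover h m
  tfae_have 3 → 4 := IsLeftModularLattice.isELShellable
  tfae_have 4 → 2 := IsELShellable.isTwoPlusTwoFree hT
  tfae_finish

theorem theorem1p2 (P : Type*) [PartialOrder P] [BoundedOrder P] [Finite P]
    (hP : ∀ m : ℕ, 0 < m → CoverPoset.IsLatticePoset (CoverPoset.MCover P m))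
    (m : ℕ) (hm : 0 < m) :
    List.TFAE [
      (Nat.card P = 1 ∨ ∃ (k l : ℕ) (w : CoverPoset.NEPath),
        Nonempty (P ≃o CoverPoset.PathPoset (CoverPoset.ChainAntichain k l) w)),
      CoverPoset.IsTwoPlusTwoFree P,
      CoverPoset.IsLeftModularLattice (CoverPoset.MCover P m),
      CoverPoset.IsELShellable (CoverPoset.MCover P m)] := by
  exact theorem1p2_general P (hP 2 two_pos) m hm
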